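/- Let $(\mathcal M,\mathcal E)$ be an exact category in the sense of Quillen, i.e. an additive category $\mathcal M$ with an exact structure $\mathcal E$ (an isomorphism-closed class of kernel–cokernel pairs, called conflations $0\to X_1\xrightarrow{x_1}X_2\xrightarrow{x_2}X_3\to 0$, satisfying the usual axioms; the maps $x_1$ are called inflations and the maps $x_2$ deflations). Let $\mathcal E(\mathcal M)$ be the category whose objects are the conflations of $\mathcal M$, viewed as complexes in degrees $-1,0,1$, and whose morphisms are the morphisms of complexes. Let $\mathcal S(\mathcal M)\subseteq\mathcal E(\mathcal M)$ be the full subcategory of split conflations. A sequence $X^\bullet\to Y^\bullet\to Z^\bullet$ in $\mathcal E(\mathcal M)$ is called a degreewise conflation if it is a conflation of $(\mathcal M,\mathcal E)$ in each degree; the class of these is again denoted by $\mathcal E$. Let $\mathcal E_0\subseteq\mathcal E$ be the class of those degreewise conflations that split in degree $0$ (the middle degree). For an additive category $\mathcal A$ and a full subcategory $\mathcal P$ closed under isomorphisms, finite direct sums and direct summands, $\mathcal A/\mathcal P$ denotes the additive category with the objects of $\mathcal A$ and with morphisms those of $\mathcal A$ modulo the morphisms that factor through an object of $\mathcal P$.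 If $\mathcal A$ carries an exact structure $\mathcal E'$, then $\mathcal P$ is called cluster tilting in $(\mathcal A,\mathcal E')$ if (1) it is strongly functorially finite: for every $X\in\mathcal A$ there are a deflation $f:P\to X$ with $P\in\mathcal P$ through which every morphism from an object of $\mathcal P$ to $X$ factors, and an inflation $g:X\to Q$ with $Q\in\mathcal P$ through which every morphism from $X$ to an object of $\mathcal P$ factors; and (2) it is maximal self-orthogonal: an object $X$ lies in $\mathcal P$ if and only if every $\mathcal E'$-conflation $0\to P\to Y\to X\to 0$ with $P\in\mathcal P$ splits, and also if and only if every $\mathcal E'$-conflation $0\to X\to Y\to P\to 0$ with $P\in\mathcal P$ splits. Then: (a) The quotient $\mathcal E(\mathcal M)/\mathcal S(\mathcal M)$ is an abelian category. (b) The degreewise conflations form an exact structure $\mathcal E$ on $\mathcal E(\mathcal M)$, the class $\mathcal E_0$ is an exact substructure of it, and $\mathcal S(\mathcal M)$ is cluster tilting in $(\mathcal E(\mathcal M),\mathcal E_0)$. (c) $\mathcal E_0$ is the only such exact substructure: if $\mathcal E'\subseteq\mathcal E$ is an exact structure on $\mathcal E(\mathcal M)$ for which $\mathcal S(\mathcal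 M)$ is cluster tilting in $(\mathcal E(\mathcal M),\mathcal E')$, then $\mathcal E'=\mathcal E_0$. -/

import Mathlib

open CategoryTheory CategoryTheory.Limits

universe v u

/-! ### Exact structures -/

section ExactStructure

variable {C : Type u} [Category.{v} C] [Preadditive C]

/-- `i` is an inflation (admissible monomorphism) for the class `𝓔` of short sequences. -/
def IsInflation (𝓔 : ObjectProperty (ShortComplex C)) {X Y : C} (i : X ⟶ Y) : Prop :=
  ∃ (Z : C) (p : Y ⟶ Z) (w : i ≫ p = 0), 𝓔 (ShortComplex.mk i p w)

/-- `p` is a deflation (admissible epimorphism) for the class `𝓔` of short sequences. -/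
def IsDeflation (𝓔 : ObjectProperty (ShortComplex C)) {Y Z : C} (p : Y ⟶ Z) : Prop :=
  ∃ (X : C) (i : X ⟶ Y) (w : i ≫ p = 0), 𝓔 (ShortComplex.mk i p w)

/-- `𝓔` is an exact structure (in the sense of Quillen) on the additive category `C`:
an isomorphism-closed class of kernel-cokernel pairs, called conflations, such that identities are
inflations and deflations, inflations and deflations are closed under composition, inflations are
stable under pushouts along arbitrary morphisms, and deflations are stable under pullbacks along
arbitrary morphisms (these pushouts and pullbacks being required to exist). -/
class IsExactStructure [HasZeroObject C] [HasBinaryBiproducts C]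
    (𝓔 : ObjectProperty (ShortComplex C)) : Prop where
  of_iso : ∀ {S T : ShortComplex C}, (S ≅ T) → 𝓔 S → 𝓔 T
  isKernel : ∀ {S : ShortComplex C}, 𝓔 S → Nonempty (IsLimit (KernelFork.ofι S.f S.zero))
  isCokernel : ∀ {S : ShortComplex C}, 𝓔 S → Nonempty (IsColimit (CokernelCofork.ofπ S.g S.zero))
  inflation_id : ∀ X : C, IsInflation 𝓔 (𝟙 X)
  deflation_id : ∀ X : C, IsDeflation 𝓔 (𝟙 X)
  inflation_comp : ∀ {X Y Z : C} (i : X ⟶ Y) (j : Y ⟶ Z),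
    IsInflation 𝓔 i → IsInflation 𝓔 j → IsInflation 𝓔 (i ≫ j)
  deflation_comp : ∀ {X Y Z : C} (p : X ⟶ Y) (q : Y ⟶ Z),
    IsDeflation 𝓔 p → IsDeflation 𝓔 q → IsDeflation 𝓔 (p ≫ q)
  exists_pushout : ∀ {X Y X' : C} (i : X ⟶ Y) (f : X ⟶ X'), IsInflation 𝓔 i →
    ∃ (Y' : C) (f' : Y ⟶ Y') (i' : X' ⟶ Y'), IsPushout i f f' i' ∧ IsInflation 𝓔 i'
  exists_pullback : ∀ {Y Z Z' : C} (p : Y ⟶ Z) (f : Z' ⟶ Z), IsDeflation 𝓔 p →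
    ∃ (Y' : C) (f' : Y' ⟶ Y) (p' : Y' ⟶ Z'), IsPullback f' p' p f ∧ IsDeflation 𝓔 p'

end ExactStructure

/-! ### Additive subcategories and the quotient category -/

section Subcategories

variable {C : Type u} [Category.{v} C] [Preadditive C] [HasZeroObject C] [HasBinaryBiproducts C]

open ZeroObject in
/-- The full subcategory `P` is an additive subcategory: it is closed under isomorphisms,
finite direct sums and direct summands. -/
class IsAdditiveSubcategory (P : ObjectProperty C) : Prop where
  of_iso : ∀ {X Y : C}, (X ≅ Y) → P X → P Y
  zero : P (0 : C)
  biprod_iff : ∀ X Y : C, P (X ⊞ Y) ↔ P X ∧ P Y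

/-- Two parallel morphisms are identified if their difference factors through an object of `P`. -/
def factorsThroughRel (P : ObjectProperty C) : HomRel C :=
  fun X Y f g ↦ ∃ (W : C) (_ : P W) (a : X ⟶ W) (b : W ⟶ Y), f - g = a ≫ b

lemma factorsThroughRel_add (P : ObjectProperty C) [IsAdditiveSubcategory P]
    {X Y : C} {W W' : C} (hW : P W) (hW' : P W') (a : X ⟶ W) (b : W ⟶ Y)
    (a' : X ⟶ W') (b' : W' ⟶ Y) :
    ∃ (V : C) (_ : P V) (c : X ⟶ V) (d : V ⟶ Y), a ≫ b + a' ≫ b' = c ≫ d :=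
  ⟨W ⊞ W', (IsAdditiveSubcategory.biprod_iff W W').2 ⟨hW, hW'⟩,
    biprod.lift a a', biprod.desc b b', by simp⟩

instance (P : ObjectProperty C) [IsAdditiveSubcategory P] :
    Congruence (factorsThroughRel P) where
  comp_left := by
    rintro X Y Z f g g' ⟨W, hW, a, b, h⟩
    exact ⟨W, hW, f ≫ a, b, by rw [← Preadditive.comp_sub, h, Category.assoc]⟩
  comp_right := by
    rintro X Y Z f f' g ⟨W, hW, a, b, h⟩
    exact ⟨W, hW, a, b ≫ g, by rw [← Preadditive.sub_comp, h, Category.assoc]⟩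
  equivalence :=
    { refl := fun f ↦ ⟨_, IsAdditiveSubcategory.zero, 0, 0, by simp⟩
      symm := by
        rintro f g ⟨W, hW, a, b, h⟩
        exact ⟨W, hW, -a, b, by rw [Preadditive.neg_comp, ← h, neg_sub]⟩
      trans := by
        rintro f g k ⟨W, hW, a, b, h⟩ ⟨W', hW', a', b', h'⟩
        obtain ⟨V, hV, c, d, e⟩ := factorsThroughRel_add P hW hW' a b a' b'
        exact ⟨V, hV, c, d, by rw [← e, ← h, ← h', sub_add_sub_cancel]⟩ }

/-- The quotient category `C / P`: the objects are those of `C`, and the morphisms are the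
morphisms of `C` modulo those which factor through an object of `P`. -/
abbrev AdditiveQuotient (P : ObjectProperty C) : Type u := Quotient (factorsThroughRel P)

/-- The additive structure of `C / P`, inherited from `C`. -/
instance AdditiveQuotient.preadditive (P : ObjectProperty C) [IsAdditiveSubcategory P] :
    Preadditive (AdditiveQuotient P) :=
  Quotient.preadditive (factorsThroughRel P) (by
    rintro X Y f₁ f₂ g₁ g₂ ⟨W, hW, a, b, h⟩ ⟨W', hW', a', b', h'⟩
    obtain ⟨V, hV, c, d, e⟩ := factorsThroughRel_add P hW hW' a b a' b'
    exact ⟨V, hV, c, d, by rw [← e, ← h, ← h', add_sub_add_comm]⟩)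

/-! ### Cluster tilting subcategories -/

/-- `f : W ⟶ X` is a `P`-precover of `X`. -/
def IsPrecover (P : ObjectProperty C) {W X : C} (f : W ⟶ X) : Prop :=
  P W ∧ ∀ (Q : C), P Q → ∀ g : Q ⟶ X, ∃ h : Q ⟶ W, h ≫ f = g

/-- `f : X ⟶ W` is a `P`-preenvelope of `X`. -/
def IsPreenvelope (P : ObjectProperty C) {X W : C} (f : X ⟶ W) : Prop :=
  P W ∧ ∀ (Q : C), P Q → ∀ g : X ⟶ Q, ∃ h : W ⟶ Q, f ≫ h = g

/-- Every object has a `P`-precover which is a deflation. -/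
def StronglyContravariantlyFinite (𝓔 : ObjectProperty (ShortComplex C))
    (P : ObjectProperty C) : Prop :=
  ∀ X : C, ∃ (W : C) (f : W ⟶ X), IsPrecover P f ∧ IsDeflation 𝓔 f

/-- Every object has a `P`-preenvelope which is an inflation. -/
def StronglyCovariantlyFinite (𝓔 : ObjectProperty (ShortComplex C))
    (P : ObjectProperty C) : Prop :=
  ∀ X : C, ∃ (W : C) (f : X ⟶ W), IsPreenvelope P f ∧ IsInflation 𝓔 f

/-- Every conflation `0 ⟶ A ⟶ Y ⟶ B ⟶ 0` splits, i.e. `Ext¹(B, A) = 0` for the exact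
structure `𝓔`. -/
def ExtVanishes (𝓔 : ObjectProperty (ShortComplex C)) (B A : C) : Prop :=
  ∀ (Y : C) (i : A ⟶ Y) (p : Y ⟶ B) (w : i ≫ p = 0),
    𝓔 (ShortComplex.mk i p w) → Nonempty (ShortComplex.mk i p w).Splitting

/-- The additive subcategory `P` is cluster tilting for the exact structure `𝓔`: it is strongly
functorially finite and maximal self-orthogonal, i.e. it coincides with its left and with its right
`Ext¹`-orthogonal. -/
structure IsClusterTilting (𝓔 : ObjectProperty (ShortComplex C)) (P : ObjectProperty C) :
    Prop where
  additive : IsAdditiveSubcategory P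
  contravariantlyFinite : StronglyContravariantlyFinite 𝓔 P
  covariantlyFinite : StronglyCovariantlyFinite 𝓔 P
  mem_iff_left : ∀ X : C, P X ↔ ∀ A : C, P A → ExtVanishes 𝓔 X A
  mem_iff_right : ∀ X : C, P X ↔ ∀ B : C, P B → ExtVanishes 𝓔 B X

end Subcategories

/-! ### The category of conflations -/

section Conflations

variable {M : Type u} [Category.{v} M] [Preadditive M]

/-- The category `𝓔(M)` of conflations: the full subcategory of the category of sequences
`X₁ ⟶ X₂ ⟶ X₃` with zero composition on those in `𝓔`. -/
abbrev ConflationCat (𝓔 : ObjectProperty (ShortComplex M)) := 𝓔.FullSubcategory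

section Additive

variable [HasZeroObject M] [HasBinaryBiproducts M]
  (𝓔 : ObjectProperty (ShortComplex M)) [IsExactStructure 𝓔]

lemma IsInflation.comp_iso {X Y Y' : M} {i : X ⟶ Y} (h : IsInflation 𝓔 i) (e : Y ≅ Y') :
    IsInflation 𝓔 (i ≫ e.hom) := by
  obtain ⟨Z, p, w, h⟩ := h
  have w' : (i ≫ e.hom) ≫ e.inv ≫ p = 0 := by simp [w]
  have e' : ShortComplex.mk i p w ≅ ShortComplex.mk (i ≫ e.hom) (e.inv ≫ p) w' :=
    ShortComplex.isoMk (Iso.refl _) e (Iso.refl _)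
  exact ⟨Z, e.inv ≫ p, w', IsExactStructure.of_iso e' h⟩

lemma IsInflation.biprod_map_id {X Y : M} {i : X ⟶ Y} (h : IsInflation 𝓔 i) (D : M) :
    IsInflation 𝓔 (biprod.map i (𝟙 D)) := by
  obtain ⟨Y', f', i', hp, hi⟩ :=
    IsExactStructure.exists_pushout i (biprod.inl : X ⟶ X ⊞ D) h
  have hq : IsPushout i (biprod.inl : X ⟶ X ⊞ D) biprod.inl (biprod.map i (𝟙 D)) :=
    ⟨⟨by simp⟩, ⟨PushoutCocone.IsColimit.mk _
      (fun s ↦ biprod.desc s.inl (biprod.inr ≫ s.inr)) (by simp)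
      (fun s ↦ by apply biprod.hom_ext' <;> simp [s.condition])
      (fun s m h₁ h₂ ↦ by
        apply biprod.hom_ext'
        · simpa using h₁
        · simp [← h₂])⟩⟩
  have := hi.comp_iso 𝓔 (hp.isoIsPushout _ _ hq)
  rwa [hp.inr_isoIsPushout_hom] at this

lemma IsInflation.id_biprod_map {X Y : M} {i : X ⟶ Y} (h : IsInflation 𝓔 i) (D : M) :
    IsInflation 𝓔 (biprod.map (𝟙 D) i) := by
  obtain ⟨Y', f', i', hp, hi⟩ :=
    IsExactStructure.exists_pushout i (biprod.inr : X ⟶ D ⊞ X) h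
  have hq : IsPushout i (biprod.inr : X ⟶ D ⊞ X) biprod.inr (biprod.map (𝟙 D) i) :=
    ⟨⟨by simp⟩, ⟨PushoutCocone.IsColimit.mk _
      (fun s ↦ biprod.desc (biprod.inl ≫ s.inr) s.inl) (by simp)
      (fun s ↦ by apply biprod.hom_ext' <;> simp [s.condition])
      (fun s m h₁ h₂ ↦ by
        apply biprod.hom_ext'
        · simp [← h₂]
        · simpa using h₁)⟩⟩
  have := hi.comp_iso 𝓔 (hp.isoIsPushout _ _ hq)
  rwa [hp.inr_isoIsPushout_hom] at this

/-- The direct sum of two sequences. -/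
noncomputable abbrev biprodSeq (S T : ShortComplex M) : ShortComplex M :=
  ShortComplex.mk (biprod.map S.f T.f) (biprod.map S.g T.g) (by
    apply biprod.hom_ext' <;> simp)

lemma biprodSeq_mem {S T : ShortComplex M} (hS : 𝓔 S) (hT : 𝓔 T) : 𝓔 (biprodSeq S T) := by
  have h : IsInflation 𝓔 (biprod.map S.f T.f) := by
    have := IsExactStructure.inflation_comp _ _
      (IsInflation.biprod_map_id 𝓔 ⟨_, S.g, S.zero, hS⟩ T.X₁)
      (IsInflation.id_biprod_map 𝓔 ⟨_, T.g, T.zero, hT⟩ S.X₂)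
    have e : biprod.map S.f (𝟙 T.X₁) ≫ biprod.map (𝟙 S.X₂) T.f = biprod.map S.f T.f := by
      apply biprod.hom_ext' <;> simp
    rwa [e] at this
  obtain ⟨Z, p, w, h⟩ := h
  obtain ⟨hp⟩ := IsExactStructure.isCokernel h
  obtain ⟨hSg⟩ := IsExactStructure.isCokernel hS
  obtain ⟨hTg⟩ := IsExactStructure.isCokernel hT
  have : Epi S.g := Cofork.IsColimit.epi hSg
  have : Epi T.g := Cofork.IsColimit.epi hTg
  have hc : IsColimit (CokernelCofork.ofπ (biprodSeq S T).g (biprodSeq S T).zero) := by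
    refine CokernelCofork.IsColimit.ofπ _ _
      (fun k hk ↦ biprod.desc
        (hSg.desc (CokernelCofork.ofπ (biprod.inl ≫ k) (by
          simpa using biprod.inl ≫= hk)))
        (hTg.desc (CokernelCofork.ofπ (biprod.inr ≫ k) (by
          simpa using biprod.inr ≫= hk)))) ?_ ?_
    · intro Z' k hk
      apply biprod.hom_ext'
      · simpa using hSg.fac (CokernelCofork.ofπ (biprod.inl ≫ k) _) WalkingParallelPair.one
      · simpa using hTg.fac (CokernelCofork.ofπ (biprod.inr ≫ k) _) WalkingParallelPair.one
    · intro Z' k hk m hm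
      apply biprod.hom_ext'
      · rw [← cancel_epi S.g]
        have := hSg.fac (CokernelCofork.ofπ (biprod.inl ≫ k) (by
          simpa using biprod.inl ≫= hk)) WalkingParallelPair.one
        simp at this
        simp [this, ← hm]
      · rw [← cancel_epi T.g]
        have := hTg.fac (CokernelCofork.ofπ (biprod.inr ≫ k) (by
          simpa using biprod.inr ≫= hk)) WalkingParallelPair.one
        simp at this
        simp [this, ← hm]
  have e : ShortComplex.mk (biprod.map S.f T.f) p w ≅ biprodSeq S T :=
    ShortComplex.isoMk (Iso.refl _) (Iso.refl _) (hp.coconePointUniqueUpToIso hc) (by simp)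
      (by simpa using (hp.comp_coconePointUniqueUpToIso_hom hc WalkingParallelPair.one).symm)
  exact IsExactStructure.of_iso e h

open ZeroObject in
instance : HasZeroObject (ConflationCat 𝓔) := by
  obtain ⟨Z, p, w, h⟩ := IsExactStructure.inflation_id (𝓔 := 𝓔) (0 : M)
  have hp : p = 0 := by rw [← Category.id_comp p, w]
  obtain ⟨hc⟩ := IsExactStructure.isCokernel h
  have : Epi p := Cofork.IsColimit.epi hc
  have hZ : IsZero Z := by
    rw [IsZero.iff_id_eq_zero, ← cancel_epi p]
    simp [hp]
  have h0 : IsZero (0 : M) := isZero_zero M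
  refine ⟨⟨⟨ShortComplex.mk _ p w, h⟩, ?_⟩⟩
  rw [IsZero.iff_id_eq_zero]
  apply ObjectProperty.hom_ext
  apply ShortComplex.hom_ext
  · exact h0.eq_of_src _ _
  · exact h0.eq_of_src _ _
  · exact hZ.eq_of_src _ _

instance : HasBinaryBiproducts (ConflationCat 𝓔) where
  has_binary_biproduct X Y := by
    let b : BinaryBicone X Y :=
      { pt := ⟨biprodSeq X.obj Y.obj, biprodSeq_mem 𝓔 X.property Y.property⟩
        fst := ObjectProperty.homMk ⟨biprod.fst, biprod.fst, biprod.fst, by simp, by simp⟩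
        snd := ObjectProperty.homMk ⟨biprod.snd, biprod.snd, biprod.snd, by simp, by simp⟩
        inl := ObjectProperty.homMk ⟨biprod.inl, biprod.inl, biprod.inl, by simp, by simp⟩
        inr := ObjectProperty.homMk ⟨biprod.inr, biprod.inr, biprod.inr, by simp, by simp⟩
        inl_fst := by apply ObjectProperty.hom_ext; apply ShortComplex.hom_ext <;> simp
        inl_snd := by apply ObjectProperty.hom_ext; apply ShortComplex.hom_ext <;> simp
        inr_fst := by apply ObjectProperty.hom_ext; apply ShortComplex.hom_ext <;> simp
        inr_snd := by apply ObjectProperty.hom_ext; apply ShortComplex.hom_ext <;> simp }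
    exact ⟨⟨b, isBinaryBilimitOfTotal b (by
      apply ObjectProperty.hom_ext
      apply ShortComplex.hom_ext
      · exact biprod.total
      · exact biprod.total
      · exact biprod.total)⟩⟩

end Additive

variable (𝓔 : ObjectProperty (ShortComplex M))

/-- The degreewise exact structure on `𝓔(M)`: a sequence of conflations is a conflation if it is
one in each of the three degrees. -/
def degreewise : ObjectProperty (ShortComplex (ConflationCat 𝓔)) :=
  fun S ↦ 𝓔 (S.map (𝓔.ι ⋙ ShortComplex.π₁)) ∧ 𝓔 (S.map (𝓔.ι ⋙ ShortComplex.π₂)) ∧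
    𝓔 (S.map (𝓔.ι ⋙ ShortComplex.π₃))

/-- The class `𝓔₀` of degreewise conflations which split in the middle degree. -/
def degreewiseMiddleSplit : ObjectProperty (ShortComplex (ConflationCat 𝓔)) :=
  fun S ↦ degreewise 𝓔 S ∧ Nonempty (S.map (𝓔.ι ⋙ ShortComplex.π₂)).Splitting

/-- The full subcategory `𝓢(M)` of split conflations. -/
def splitConflations : ObjectProperty (ConflationCat 𝓔) :=
  fun X ↦ Nonempty X.obj.Splitting

lemma splitConflations_of_retract {X Y : ConflationCat 𝓔} (i : X ⟶ Y) (p : Y ⟶ X)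
    (h : i ≫ p = 𝟙 X) (hY : splitConflations 𝓔 Y) : splitConflations 𝓔 X := by
  obtain ⟨s⟩ := hY
  have h' : i.hom ≫ p.hom = 𝟙 X.obj := by rw [← ObjectProperty.FullSubcategory.comp_hom, h]; rfl
  have h₁ : i.hom.τ₁ ≫ p.hom.τ₁ = 𝟙 _ := by rw [← ShortComplex.comp_τ₁, h']; rfl
  have h₂ : i.hom.τ₂ ≫ p.hom.τ₂ = 𝟙 _ := by rw [← ShortComplex.comp_τ₂, h']; rfl
  have h₃ : i.hom.τ₃ ≫ p.hom.τ₃ = 𝟙 _ := by rw [← ShortComplex.comp_τ₃, h']; rfl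
  refine ⟨⟨i.hom.τ₂ ≫ s.r ≫ p.hom.τ₁, i.hom.τ₃ ≫ s.s ≫ p.hom.τ₂, ?_, ?_, ?_⟩⟩
  · rw [← i.hom.comm₁₂_assoc, s.f_r_assoc, h₁]
  · rw [Category.assoc, Category.assoc, p.hom.comm₂₃, s.s_g_assoc, h₃]
  · have : i.hom.τ₂ ≫ (s.r ≫ Y.obj.f + Y.obj.g ≫ s.s) ≫ p.hom.τ₂ = 𝟙 _ := by
      rw [s.id, Category.id_comp, h₂]
    rw [← this]
    simp [p.hom.comm₁₂, ← i.hom.comm₂₃_assoc]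

open ZeroObject in
instance [HasZeroObject M] [HasBinaryBiproducts M] [IsExactStructure 𝓔] :
    IsAdditiveSubcategory (splitConflations 𝓔) where
  of_iso e h := splitConflations_of_retract 𝓔 e.inv e.hom e.inv_hom_id h
  zero := by
    have h : 𝟙 (0 : ConflationCat 𝓔).obj = 0 :=
      congrArg InducedCategory.Hom.hom
        ((isZero_zero (ConflationCat 𝓔)).eq_of_src (𝟙 (0 : ConflationCat 𝓔)) 0)
    refine ⟨⟨0, 0, ?_, ?_, ?_⟩⟩
    · simpa using (congrArg ShortComplex.Hom.τ₁ h).symm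
    · simpa using (congrArg ShortComplex.Hom.τ₃ h).symm
    · simpa using (congrArg ShortComplex.Hom.τ₂ h).symm
  biprod_iff X Y := by
    refine ⟨fun h ↦ ⟨splitConflations_of_retract 𝓔 biprod.inl biprod.fst (by simp) h,
      splitConflations_of_retract 𝓔 biprod.inr biprod.snd (by simp) h⟩, ?_⟩
    rintro ⟨⟨s⟩, ⟨t⟩⟩
    let p : X ⊞ Y ⟶ X := biprod.fst
    let q : X ⊞ Y ⟶ Y := biprod.snd
    let i : X ⟶ X ⊞ Y := biprod.inl
    let j : Y ⟶ X ⊞ Y := biprod.inr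
    have h : p.hom ≫ i.hom + q.hom ≫ j.hom = 𝟙 (X ⊞ Y).obj :=
      congrArg InducedCategory.Hom.hom (biprod.total : _ = 𝟙 (X ⊞ Y))
    have h₁ : p.hom.τ₁ ≫ i.hom.τ₁ + q.hom.τ₁ ≫ j.hom.τ₁ = 𝟙 _ := congrArg ShortComplex.Hom.τ₁ h
    have h₂ : p.hom.τ₂ ≫ i.hom.τ₂ + q.hom.τ₂ ≫ j.hom.τ₂ = 𝟙 _ := congrArg ShortComplex.Hom.τ₂ h
    have h₃ : p.hom.τ₃ ≫ i.hom.τ₃ + q.hom.τ₃ ≫ j.hom.τ₃ = 𝟙 _ := congrArg ShortComplex.Hom.τ₃ h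
    refine ⟨⟨p.hom.τ₂ ≫ s.r ≫ i.hom.τ₁ + q.hom.τ₂ ≫ t.r ≫ j.hom.τ₁,
      p.hom.τ₃ ≫ s.s ≫ i.hom.τ₂ + q.hom.τ₃ ≫ t.s ≫ j.hom.τ₂, ?_, ?_, ?_⟩⟩
    · rw [← h₁, Preadditive.comp_add, ← p.hom.comm₁₂_assoc, ← q.hom.comm₁₂_assoc,
        s.f_r_assoc, t.f_r_assoc]
    · rw [← h₃, Preadditive.add_comp, Category.assoc, Category.assoc, Category.assoc,
        Category.assoc, i.hom.comm₂₃, j.hom.comm₂₃, s.s_g_assoc, t.s_g_assoc]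
    · have e₁ : p.hom.τ₂ ≫ (s.r ≫ X.obj.f + X.obj.g ≫ s.s) ≫ i.hom.τ₂ +
          q.hom.τ₂ ≫ (t.r ≫ Y.obj.f + Y.obj.g ≫ t.s) ≫ j.hom.τ₂ = 𝟙 _ := by
        rw [s.id, t.id, Category.id_comp, Category.id_comp, h₂]
      rw [← e₁]
      simp only [Preadditive.add_comp, Preadditive.comp_add, Category.assoc, i.hom.comm₁₂,
        j.hom.comm₁₂, ← p.hom.comm₂₃_assoc, ← q.hom.comm₂₃_assoc]
      abel

end Conflations

/-! Abelian quotient. Split conflations are contractible, so a morphism vanishes in the quotient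
exactly when it is null-homotopic, and this can be read off from either outer component alone
(`map_eq_zero_iff_left`, `map_eq_zero_iff_right`). Hence a morphism invertible on subobjects becomes
mono, and one invertible on quotient objects becomes epi. Pushing X out along `f.hom.τ₁` factors f
as such an epi e followed by such a mono m. The mapping-cone conflations X₁ → X₂ ⊞ Z₁ → Z₂ of e and
Z₂ → Z₃ ⊞ Y₂ → Y₃ of m give a kernel of e and a cokernel of m; moreover e is the cokernel of its
kernel and m the kernel of its cokernel.

Exact structures. Degreewise conflations of arbitrary complexes form an exact structure. The
complexes that are conflations are closed under extensions (`mem_of_extension`), so the structure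
restricts to them. Being split in the middle degree means being split after the functor X ↦ X₂,
which cuts out an exact substructure. For it, every X has a resolution and a coresolution of length
one by split conflations, ending in 0 → X₁ → X₁ and X₃ → X₃ → 0 respectively. Together with the
vanishing of extensions between split conflations, these give cluster tilting.

Uniqueness. Two comparisons, both of the same shape: pull a conflation back to a split conflation
and push it out to another; the result splits by orthogonality. With test maps that are identities
in the middle degree, this forces the middle degree to split (`le_degreewiseMiddleSplit`). With the
approximations supplied by strong functorial finiteness, the obscure axiom carries admissibility
back to the original sequence (`le_of_extVanishes`). -/

section UniversalProperties

/-! ### Universal properties from joint cancellation and mere existence of factorizations -/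

variable {C : Type u} [Category.{v} C]

lemma isPullback_of_exists_lift {P X Y Z : C} {fst : P ⟶ X} {snd : P ⟶ Y} {f : X ⟶ Z} {g : Y ⟶ Z}
    (w : fst ≫ f = snd ≫ g)
    (hom_ext : ∀ {T : C} (a b : T ⟶ P), a ≫ fst = b ≫ fst → a ≫ snd = b ≫ snd → a = b)
    (lift : ∀ {T : C} (a : T ⟶ X) (b : T ⟶ Y), a ≫ f = b ≫ g →
      ∃ l : T ⟶ P, l ≫ fst = a ∧ l ≫ snd = b) : IsPullback fst snd f g :=
  ⟨⟨w⟩, ⟨PullbackCone.IsLimit.mk _ (fun s ↦ (lift s.fst s.snd s.condition).choose)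
    (fun s ↦ (lift s.fst s.snd s.condition).choose_spec.1)
    (fun s ↦ (lift s.fst s.snd s.condition).choose_spec.2)
    (fun s _ h₁ h₂ ↦ hom_ext _ _
      (h₁.trans (lift s.fst s.snd s.condition).choose_spec.1.symm)
      (h₂.trans (lift s.fst s.snd s.condition).choose_spec.2.symm))⟩⟩

lemma isPushout_of_exists_desc {P X Y Z : C} {f : Z ⟶ X} {g : Z ⟶ Y} {inl : X ⟶ P} {inr : Y ⟶ P}
    (w : f ≫ inl = g ≫ inr)
    (hom_ext : ∀ {T : C} (a b : P ⟶ T), inl ≫ a = inl ≫ b → inr ≫ a = inr ≫ b → a = b)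
    (desc : ∀ {T : C} (a : X ⟶ T) (b : Y ⟶ T), f ≫ a = g ≫ b →
      ∃ l : P ⟶ T, inl ≫ l = a ∧ inr ≫ l = b) : IsPushout f g inl inr :=
  ⟨⟨w⟩, ⟨PushoutCocone.IsColimit.mk _ (fun s ↦ (desc s.inl s.inr s.condition).choose)
    (fun s ↦ (desc s.inl s.inr s.condition).choose_spec.1)
    (fun s ↦ (desc s.inl s.inr s.condition).choose_spec.2)
    (fun s _ h₁ h₂ ↦ hom_ext _ _
      (h₁.trans (desc s.inl s.inr s.condition).choose_spec.1.symm)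
      (h₂.trans (desc s.inl s.inr s.condition).choose_spec.2.symm))⟩⟩

lemma nonempty_isLimit_kernelFork [HasZeroMorphisms C] {X Y Z : C} {i : X ⟶ Y} {p : Y ⟶ Z}
    (w : i ≫ p = 0) (hom_ext : ∀ {T : C} (a b : T ⟶ X), a ≫ i = b ≫ i → a = b)
    (lift : ∀ {T : C} (k : T ⟶ Y), k ≫ p = 0 → ∃ l : T ⟶ X, l ≫ i = k) :
    Nonempty (IsLimit (KernelFork.ofι i w)) :=
  ⟨KernelFork.IsLimit.ofι _ _ (fun k hk ↦ (lift k hk).choose)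
    (fun k hk ↦ (lift k hk).choose_spec)
    (fun k hk _ hm ↦ hom_ext _ _ (hm.trans (lift k hk).choose_spec.symm))⟩

lemma nonempty_isColimit_cokernelCofork [HasZeroMorphisms C] {X Y Z : C} {i : X ⟶ Y} {p : Y ⟶ Z}
    (w : i ≫ p = 0) (hom_ext : ∀ {T : C} (a b : Z ⟶ T), p ≫ a = p ≫ b → a = b)
    (desc : ∀ {T : C} (k : Y ⟶ T), i ≫ k = 0 → ∃ l : Z ⟶ T, p ≫ l = k) :
    Nonempty (IsColimit (CokernelCofork.ofπ p w)) :=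
  ⟨CokernelCofork.IsColimit.ofπ _ _ (fun k hk ↦ (desc k hk).choose)
    (fun k hk ↦ (desc k hk).choose_spec)
    (fun k hk _ hm ↦ hom_ext _ _ (hm.trans (desc k hk).choose_spec.symm))⟩

end UniversalProperties

/-! ### Diagram lemmas in an exact category -/

namespace IsExactStructure

variable {C : Type u} [Category.{v} C] [Preadditive C] {𝓔 : ObjectProperty (ShortComplex C)}

lemma isInflation {S : ShortComplex C} (h : 𝓔 S) : IsInflation 𝓔 S.f := ⟨_, _, _, h⟩

lemma isDeflation {S : ShortComplex C} (h : 𝓔 S) : IsDeflation 𝓔 S.g := ⟨_, _, _, h⟩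

variable [HasZeroObject C] [HasBinaryBiproducts C] [IsExactStructure 𝓔]

lemma mono_f {S : ShortComplex C} (h : 𝓔 S) : Mono S.f :=
  Fork.IsLimit.mono (isKernel h).some

lemma epi_g {S : ShortComplex C} (h : 𝓔 S) : Epi S.g :=
  Cofork.IsColimit.epi (isCokernel h).some

lemma exists_lift {S : ShortComplex C} (h : 𝓔 S) {T : C} (k : T ⟶ S.X₂) (hk : k ≫ S.g = 0) :
    ∃ l : T ⟶ S.X₁, l ≫ S.f = k :=
  ⟨_, (KernelFork.IsLimit.lift' (isKernel h).some k hk).2⟩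

lemma exists_desc {S : ShortComplex C} (h : 𝓔 S) {T : C} (k : S.X₂ ⟶ T) (hk : S.f ≫ k = 0) :
    ∃ l : S.X₃ ⟶ T, S.g ≫ l = k :=
  ⟨_, (CokernelCofork.IsColimit.desc' (isCokernel h).some k hk).2⟩

/-- Cokernels are unique up to isomorphism and the class is isomorphism-closed, so for a sequence
with the right cokernel only admissibility of the first map has to be checked. -/
lemma mem_of_isInflation {S : ShortComplex C} (hi : IsInflation 𝓔 S.f)
    (hS : Nonempty (IsColimit (CokernelCofork.ofπ S.g S.zero))) : 𝓔 S := by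
  obtain ⟨Z, p, w, h⟩ := hi
  have e := (isCokernel h).some.comp_coconePointUniqueUpToIso_hom hS.some WalkingParallelPair.one
  refine of_iso ?_ h
  exact ShortComplex.isoMk (Iso.refl _) (Iso.refl _)
    ((isCokernel h).some.coconePointUniqueUpToIso hS.some) (by simp) (by simpa using e.symm)

lemma mem_of_isDeflation {S : ShortComplex C} (hp : IsDeflation 𝓔 S.g)
    (hS : Nonempty (IsLimit (KernelFork.ofι S.f S.zero))) : 𝓔 S := by
  obtain ⟨Z, i, w, h⟩ := hp
  have e := (isKernel h).some.conePointUniqueUpToIso_hom_comp hS.some WalkingParallelPair.zero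
  refine of_iso ?_ h
  exact ShortComplex.isoMk ((isKernel h).some.conePointUniqueUpToIso hS.some)
    (Iso.refl _) (Iso.refl _) (by simpa using e) (by simp)

lemma isDeflation_iso_comp {Y Y' Z : C} (e : Y' ≅ Y) {p : Y ⟶ Z} (h : IsDeflation 𝓔 p) :
    IsDeflation 𝓔 (e.hom ≫ p) := by
  obtain ⟨X, i, w, h⟩ := h
  refine ⟨X, i ≫ e.inv, by simp [w], of_iso ?_ h⟩
  exact ShortComplex.isoMk (Iso.refl _) e.symm (Iso.refl _) (by simp) (by simp)

variable (𝓔) in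
lemma mem_id_zero (X : C) {Z : C} (hZ : IsZero Z) :
    𝓔 (ShortComplex.mk (𝟙 X) (0 : X ⟶ Z) (by simp)) :=
  mem_of_isInflation (inflation_id X) (nonempty_isColimit_cokernelCofork _
    (fun a b _ ↦ hZ.eq_of_src a b) (fun k hk ↦ ⟨0, by simpa using hk.symm⟩))

variable (𝓔) in
lemma mem_zero_id {Z : C} (hZ : IsZero Z) (X : C) :
    𝓔 (ShortComplex.mk (0 : Z ⟶ X) (𝟙 X) (by simp)) :=
  mem_of_isDeflation (deflation_id X) (nonempty_isLimit_kernelFork _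
    (fun a b _ ↦ hZ.eq_of_tgt a b) (fun k hk ↦ ⟨0, by simpa using hk.symm⟩))

/-- A pushout does not change the cokernel, and the pushout square provided by the axiom is
isomorphic to any given one. -/
lemma mem_of_isPushout {S : ShortComplex C} (h : 𝓔 S) {X Y : C} {f : S.X₁ ⟶ X} {f' : S.X₂ ⟶ Y}
    {i : X ⟶ Y} (sq : IsPushout S.f f f' i) {p : Y ⟶ S.X₃} (w : i ≫ p = 0) (hp : f' ≫ p = S.g) :
    𝓔 (ShortComplex.mk i p w) := by
  have := epi_g h
  obtain ⟨Y', f'', i', sq', hi⟩ := exists_pushout S.f f (isInflation h)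
  have hi' := hi.comp_iso 𝓔 (sq'.isoIsPushout _ _ sq)
  rw [sq'.inr_isoIsPushout_hom] at hi'
  refine mem_of_isInflation hi' (nonempty_isColimit_cokernelCofork _ (fun a b hab ↦ ?_)
    (fun k hk ↦ ?_))
  · rw [← cancel_epi S.g, ← hp, Category.assoc, hab, Category.assoc]
  · obtain ⟨l, hl⟩ := exists_desc h (f' ≫ k) (by
      rw [sq.w_assoc]; dsimp at hk; rw [hk, comp_zero])
    refine ⟨l, sq.hom_ext ?_ ?_⟩
    · dsimp; rw [reassoc_of% hp, hl]
    · dsimp at hk ⊢; rw [reassoc_of% w, hk, zero_comp]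

lemma mem_of_isPullback {S : ShortComplex C} (h : 𝓔 S) {Y Z : C} {f' : Y ⟶ S.X₂} {p : Y ⟶ Z}
    {f : Z ⟶ S.X₃} (sq : IsPullback f' p S.g f) {i : S.X₁ ⟶ Y} (w : i ≫ p = 0)
    (hi : i ≫ f' = S.f) : 𝓔 (ShortComplex.mk i p w) := by
  have := mono_f h
  obtain ⟨Y', f'', p', sq', hp⟩ := exists_pullback S.g f (isDeflation h)
  have hp' := isDeflation_iso_comp (sq.isoIsPullback _ _ sq') hp
  rw [sq.isoIsPullback_hom_snd] at hp'
  refine mem_of_isDeflation hp' (nonempty_isLimit_kernelFork _ (fun a b hab ↦ ?_)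
    (fun k hk ↦ ?_))
  · dsimp at hab; rw [← cancel_mono S.f, ← hi, reassoc_of% hab]
  · dsimp at hk
    obtain ⟨l, hl⟩ := exists_lift h (k ≫ f') (by
      rw [Category.assoc, sq.w, reassoc_of% hk, zero_comp])
    refine ⟨l, sq.hom_ext ?_ ?_⟩
    · dsimp; rw [Category.assoc, hi, hl]
    · dsimp; rw [Category.assoc, w, hk, comp_zero]

lemma exists_mem_isPushout {A B D : C} {j : A ⟶ B} {q : B ⟶ D} {w₀ : j ≫ q = 0}
    (h : 𝓔 (ShortComplex.mk j q w₀)) {X : C} (f : A ⟶ X) :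
    ∃ (Y : C) (f' : B ⟶ Y) (i : X ⟶ Y) (p : Y ⟶ D) (w : i ≫ p = 0),
      IsPushout j f f' i ∧ f' ≫ p = q ∧ 𝓔 (ShortComplex.mk i p w) := by
  obtain ⟨Y, f', i, sq, -⟩ := exists_pushout j f (isInflation h)
  obtain ⟨p, hp, w⟩ := sq.exists_desc q 0 (by simp [w₀])
  exact ⟨Y, f', i, p, w, sq, hp, mem_of_isPushout h sq w hp⟩

lemma exists_mem_isPullback {A B D : C} {j : A ⟶ B} {q : B ⟶ D} {w₀ : j ≫ q = 0}
    (h : 𝓔 (ShortComplex.mk j q w₀)) {Z : C} (f : Z ⟶ D) :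
    ∃ (Y : C) (f' : Y ⟶ B) (i : A ⟶ Y) (p : Y ⟶ Z) (w : i ≫ p = 0),
      IsPullback f' p q f ∧ i ≫ f' = j ∧ 𝓔 (ShortComplex.mk i p w) := by
  obtain ⟨Y, f', p, sq, -⟩ := exists_pullback q f (isDeflation h)
  obtain ⟨i, hi, w⟩ := sq.exists_lift j 0 (by simp [w₀])
  exact ⟨Y, f', i, p, w, sq, hi, mem_of_isPullback h sq w hi⟩

/-- The mapping-cone sequence: `S.X₂ ⊞ T.X₁` is the pullback of `S.g` along `T.g ≫ inv φ.τ₃`, so the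
sequence is a base change of S. It serves both for bicartesian squares and for kernels in the
quotient category. -/
lemma biprod_mem_of_isIso_τ₃ {S T : ShortComplex C} (hS : 𝓔 S) (hT : 𝓔 T) (φ : S ⟶ T)
    [IsIso φ.τ₃] :
    𝓔 (ShortComplex.mk (biprod.lift S.f φ.τ₁) (biprod.desc φ.τ₂ (-T.f)) (by simp [φ.comm₁₂])) := by
  have sq : IsPullback (biprod.fst : S.X₂ ⊞ T.X₁ ⟶ S.X₂) (biprod.desc φ.τ₂ (-T.f)) S.g
      (T.g ≫ inv φ.τ₃) := by
    have := mono_f hT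
    refine isPullback_of_exists_lift ?_ (fun a b h₁ h₂ ↦ ?_) (fun a b hab ↦ ?_)
    · rw [← cancel_mono φ.τ₃]
      apply biprod.hom_ext' <;> simp [φ.comm₂₃]
    · apply biprod.hom_ext _ _ h₁
      rw [biprod.desc_eq, Preadditive.comp_add, Preadditive.comp_add, ← Category.assoc,
        ← Category.assoc, h₁, Category.assoc, add_right_inj] at h₂
      simpa [← cancel_mono T.f] using h₂
    · rw [← cancel_mono φ.τ₃] at hab
      obtain ⟨l, hl⟩ := exists_lift hT (a ≫ φ.τ₂ - b) (by
        simpa [sub_eq_zero, φ.comm₂₃] using hab)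
      exact ⟨biprod.lift a l, by simp, by simp [hl]⟩
  exact mem_of_isPullback (S := ShortComplex.mk S.f S.g S.zero) hS sq _ (by simp)

lemma isPushout_of_isIso_τ₃ {S T : ShortComplex C} (hS : 𝓔 S) (hT : 𝓔 T) (φ : S ⟶ T)
    [IsIso φ.τ₃] : IsPushout S.f φ.τ₁ φ.τ₂ T.f := by
  have h := biprod_mem_of_isIso_τ₃ hS hT φ
  have := epi_g h
  refine isPushout_of_exists_desc φ.comm₁₂.symm (fun a b h₁ h₂ ↦ ?_) (fun a b hab ↦ ?_)
  · rw [← cancel_epi (biprod.desc φ.τ₂ (-T.f))]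
    apply biprod.hom_ext' <;> simp [h₁, h₂]
  · obtain ⟨l, hl⟩ := exists_desc h (biprod.desc a (-b)) (by simp [hab])
    refine ⟨l, ?_, ?_⟩
    · simpa using biprod.inl ≫= hl
    · simpa using biprod.inr ≫= hl

lemma biprod_mem_of_isIso_τ₁ {S T : ShortComplex C} (hS : 𝓔 S) (hT : 𝓔 T) (φ : S ⟶ T)
    [IsIso φ.τ₁] :
    𝓔 (ShortComplex.mk (biprod.lift S.g φ.τ₂) (biprod.desc φ.τ₃ (-T.g)) (by simp [φ.comm₂₃])) := by
  -- Both signs are needed: the first makes the induced map to `T.X₃` restrict to `T.g`, the second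
  -- keeps the square commutative.
  have sq : IsPushout T.f (inv φ.τ₁ ≫ S.f) (-biprod.inr : T.X₂ ⟶ S.X₃ ⊞ T.X₂)
      (-biprod.lift S.g φ.τ₂) := by
    have := epi_g hS
    refine isPushout_of_exists_desc ?_ (fun a b h₁ h₂ ↦ ?_) (fun a b hab ↦ ?_)
    · rw [← cancel_epi φ.τ₁]
      apply biprod.hom_ext <;> simp [φ.comm₁₂]
    · have h₁' : biprod.inr ≫ a = biprod.inr ≫ b := by simpa using h₁
      refine biprod.hom_ext' _ _ ?_ h₁'
      rw [biprod.lift_eq] at h₂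
      simpa [h₁', cancel_epi] using h₂
    · rw [← cancel_epi φ.τ₁] at hab
      obtain ⟨l, hl⟩ := exists_desc hS (φ.τ₂ ≫ a - b) (by
        simpa [sub_eq_zero, ← φ.comm₁₂_assoc] using hab)
      exact ⟨biprod.desc l (-a), by simp, by simp [hl]⟩
  have h := mem_of_isPushout (S := ShortComplex.mk T.f T.g T.zero) hT sq
    (p := biprod.desc φ.τ₃ (-T.g)) (by simp [φ.comm₂₃]) (by simp)
  -- The conflation just obtained starts with `-biprod.lift S.g φ.τ₂`; the automorphism -1 of `S.X₂`
  -- removes the sign.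
  let e : S.X₂ ≅ S.X₂ := ⟨-𝟙 _, -𝟙 _, by simp, by simp⟩
  refine of_iso ?_ h
  exact ShortComplex.isoMk e (Iso.refl _) (Iso.refl _) (by simp [e]) (by simp)

lemma isPullback_of_isIso_τ₁ {S T : ShortComplex C} (hS : 𝓔 S) (hT : 𝓔 T) (φ : S ⟶ T)
    [IsIso φ.τ₁] : IsPullback S.g φ.τ₂ φ.τ₃ T.g := by
  have h := biprod_mem_of_isIso_τ₁ hS hT φ
  have := mono_f h
  refine isPullback_of_exists_lift φ.comm₂₃.symm (fun a b h₁ h₂ ↦ ?_) (fun a b hab ↦ ?_)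
  · rw [← cancel_mono (biprod.lift S.g φ.τ₂)]
    apply biprod.hom_ext <;> simp [h₁, h₂]
  · obtain ⟨l, hl⟩ := exists_lift h (biprod.lift a b) (by simp [hab])
    refine ⟨l, ?_, ?_⟩
    · simpa using hl =≫ biprod.fst
    · simpa using hl =≫ biprod.snd

/-- The short five lemma: the left square is a pushout, so `φ.τ₂` is a pushout of the isomorphism
`φ.τ₁`. -/
lemma isIso_τ₂ {S T : ShortComplex C} (hS : 𝓔 S) (hT : 𝓔 T) (φ : S ⟶ T)
    [IsIso φ.τ₁] [IsIso φ.τ₃] : IsIso φ.τ₂ :=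
  (isPushout_of_isIso_τ₃ hS hT φ).isIso_inl_of_isIso

/-- The third isomorphism theorem for the composition of two inflations. -/
lemma exists_mem_comp_inflation {X Y Z A B : C} {i : X ⟶ Y} {p : Y ⟶ A} {j : Y ⟶ Z} {q : Z ⟶ B}
    (w : i ≫ p = 0) (w' : j ≫ q = 0) (h : 𝓔 (ShortComplex.mk i p w))
    (h' : 𝓔 (ShortComplex.mk j q w')) :
    ∃ (D : C) (c : Z ⟶ D) (a : A ⟶ D) (b : D ⟶ B) (w₁ : (i ≫ j) ≫ c = 0) (w₂ : a ≫ b = 0),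
      𝓔 (ShortComplex.mk (i ≫ j) c w₁) ∧ 𝓔 (ShortComplex.mk a b w₂) ∧ j ≫ c = p ≫ a ∧
        c ≫ b = q := by
  -- The cokernel of `i ≫ j` is the pushout of `p` along `j`, which also exhibits it as an extension
  -- of B by A.
  obtain ⟨D, c, a, b, w₂, sq, hcb, hab⟩ := exists_mem_isPushout h' p
  have w₁ : (i ≫ j) ≫ c = 0 := by rw [Category.assoc, sq.w, reassoc_of% w, zero_comp]
  refine ⟨D, c, a, b, w₁, w₂, mem_of_isInflation (inflation_comp _ _ (isInflation h)
    (isInflation h')) (nonempty_isColimit_cokernelCofork _ (fun f g hfg ↦ ?_)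
      (fun k hk ↦ ?_)), hab, sq.w, hcb⟩
  · have : Epi p := epi_g h
    refine sq.hom_ext hfg ?_
    dsimp at hfg
    rw [← cancel_epi p, ← sq.w_assoc, hfg, sq.w_assoc]
  · obtain ⟨l, hl⟩ := exists_desc h (j ≫ k) (by simpa using hk)
    exact ⟨_, (sq.exists_desc k l hl.symm).choose_spec.1⟩

/-- Dually, the kernel of `p ≫ q` is the pullback of `j` along `p`, an extension of B by A. That
extension is what keeps kernels inside an extension-closed subcategory. -/
lemma exists_mem_comp_deflation {X Y Z A B : C} {p : X ⟶ Y} {i : A ⟶ X} {q : Y ⟶ Z} {j : B ⟶ Y}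
    (w : i ≫ p = 0) (w' : j ≫ q = 0) (h : 𝓔 (ShortComplex.mk i p w))
    (h' : 𝓔 (ShortComplex.mk j q w')) :
    ∃ (D : C) (c : D ⟶ X) (a : A ⟶ D) (b : D ⟶ B) (w₁ : c ≫ p ≫ q = 0) (w₂ : a ≫ b = 0),
      𝓔 (ShortComplex.mk c (p ≫ q) w₁) ∧ 𝓔 (ShortComplex.mk a b w₂) ∧ c ≫ p = b ≫ j ∧
        a ≫ c = i := by
  obtain ⟨D, c, a, b, w₂, sq, hac, hab⟩ := exists_mem_isPullback h j
  have w₁ : c ≫ p ≫ q = 0 := by rw [sq.w_assoc, w', comp_zero]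
  refine ⟨D, c, a, b, w₁, w₂, mem_of_isDeflation (deflation_comp _ _ (isDeflation h)
    (isDeflation h')) (nonempty_isLimit_kernelFork _ (fun f g hfg ↦ ?_)
      (fun k hk ↦ ?_)), hab, sq.w, hac⟩
  · have : Mono j := mono_f h'
    refine sq.hom_ext hfg ?_
    dsimp at hfg
    rw [← cancel_mono j, Category.assoc, ← sq.w, reassoc_of% hfg, Category.assoc, sq.w]
  · obtain ⟨l, hl⟩ := exists_lift h' (k ≫ p) (by simpa using hk)
    exact ⟨_, (sq.exists_lift k l hl.symm).choose_spec.1⟩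

/-- A complex which is a degreewise extension of two conflations is a conflation. -/
lemma mem_of_extension {S : ShortComplex (ShortComplex C)} (h₁ : 𝓔 (S.map ShortComplex.π₁))
    (h₂ : 𝓔 (S.map ShortComplex.π₂)) (h₃ : 𝓔 (S.map ShortComplex.π₃))
    (hA : 𝓔 S.X₁) (hC : 𝓔 S.X₃) : 𝓔 S.X₂ := by
  have r₁ : S.f.τ₁ ≫ S.g.τ₁ = 0 := congrArg ShortComplex.Hom.τ₁ S.zero
  have r₂ : S.f.τ₂ ≫ S.g.τ₂ = 0 := congrArg ShortComplex.Hom.τ₂ S.zero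
  have r₃ : S.f.τ₃ ≫ S.g.τ₃ = 0 := congrArg ShortComplex.Hom.τ₃ S.zero
  replace h₁ : 𝓔 (ShortComplex.mk S.f.τ₁ S.g.τ₁ r₁) := h₁
  replace h₂ : 𝓔 (ShortComplex.mk S.f.τ₂ S.g.τ₂ r₂) := h₂
  replace h₃ : 𝓔 (ShortComplex.mk S.f.τ₃ S.g.τ₃ r₃) := h₃
  -- Write A → B → C for S and P for the pushout of A₂ and B₁ over A₁. Then the first map of B
  -- factors as `b ≫ m`, where `b` is a pushout of `A₁ → A₂` with cokernel A₃, and `m` is a pullback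
  -- of `C₁ → C₂` with cokernel C₃. The composite is therefore an inflation whose cokernel is an
  -- extension of C₃ by A₃.
  obtain ⟨P, b, i, p, w, sq, hbp, hP⟩ := exists_mem_isPushout h₁ S.X₁.f
  obtain ⟨u, hu, wu⟩ := sq.exists_desc 0 S.X₁.g (by simp)
  have hbu : 𝓔 (ShortComplex.mk b u hu) := mem_of_isPushout hA sq.flip _ wu
  obtain ⟨m, hbm, him⟩ := sq.exists_desc S.X₂.f S.f.τ₂ S.f.comm₁₂
  have hmp : m ≫ S.g.τ₂ = p ≫ S.X₃.f := by
    apply sq.hom_ext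
    · simp [reassoc_of% hbm, reassoc_of% hbp, S.g.comm₁₂]
    · simp [reassoc_of% him, reassoc_of% w, r₂]
  have sq₂ : IsPullback p m S.X₃.f S.g.τ₂ := by
    let φ : ShortComplex.mk i p w ⟶ ShortComplex.mk S.f.τ₂ S.g.τ₂ r₂ :=
      ⟨𝟙 _, m, S.X₃.f, by simp [him], by simp [hmp]⟩
    have : IsIso φ.τ₁ := inferInstanceAs (IsIso (𝟙 _))
    exact isPullback_of_isIso_τ₁ hP h₂ φ
  have wm : m ≫ S.g.τ₂ ≫ S.X₃.g = 0 := by rw [reassoc_of% hmp, S.X₃.zero, comp_zero]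
  have hm : 𝓔 (ShortComplex.mk m (S.g.τ₂ ≫ S.X₃.g) wm) := by
    have := mono_f hC
    refine mem_of_isDeflation (deflation_comp _ _ (isDeflation h₂) (isDeflation hC))
      (nonempty_isLimit_kernelFork _ (fun f g hfg ↦ ?_) (fun k hk ↦ ?_))
    · refine sq₂.hom_ext ?_ hfg
      dsimp at hfg
      rw [← cancel_mono S.X₃.f, Category.assoc, ← hmp, reassoc_of% hfg, hmp, Category.assoc]
    · obtain ⟨l, hl⟩ := exists_lift hC (k ≫ S.g.τ₂) (by simpa using hk)
      exact ⟨_, (sq₂.exists_lift l k hl).choose_spec.2⟩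
  obtain ⟨D, c, a, d, w₁, w₂, hD, had, hmc, hcd⟩ := exists_mem_comp_inflation _ _ hbu hm
  have : Epi u := epi_g hbu
  have : Epi c := epi_g hD
  obtain ⟨v, hv⟩ := exists_desc hD S.X₂.g (by simp [hbm])
  dsimp at hv
  have hav : a ≫ v = S.f.τ₃ := by
    rw [← cancel_epi u, ← reassoc_of% hmc, hv]
    apply sq.hom_ext
    · simp [reassoc_of% hbm, reassoc_of% hu]
    · simp [reassoc_of% him, reassoc_of% wu, S.f.comm₂₃]
  have hvd : v ≫ S.g.τ₃ = d := by
    rw [← cancel_epi c, reassoc_of% hv, hcd, S.g.comm₂₃]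
  -- Both D and `S.X₂.X₃` are extensions of C₃ by A₃, and `v` is compatible with them, so the five
  -- lemma applies.
  have : IsIso v := by
    let φ : ShortComplex.mk a d w₂ ⟶ ShortComplex.mk S.f.τ₃ S.g.τ₃ r₃ :=
      ⟨𝟙 _, v, 𝟙 _, by simp [hav], by simp [hvd]⟩
    have : IsIso φ.τ₁ := inferInstanceAs (IsIso (𝟙 _))
    have : IsIso φ.τ₃ := inferInstanceAs (IsIso (𝟙 _))
    exact isIso_τ₂ had h₃ φ
  refine of_iso ?_ hD
  exact ShortComplex.isoMk (Iso.refl _) (Iso.refl _) (asIso v) (by simp [hbm]) (by simp [hv])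

/-- A split sequence is the direct sum of an identity followed by a zero map and a zero map followed
by an identity, both of which are conflations. -/
lemma mem_of_splitting {S : ShortComplex C} (s : S.Splitting) : 𝓔 S := by
  have h := biprodSeq_mem 𝓔 (mem_id_zero 𝓔 S.X₁ (isZero_zero C))
    (mem_zero_id 𝓔 (isZero_zero C) S.X₃)
  refine of_iso ?_ h
  refine ShortComplex.isoMk ⟨biprod.fst, biprod.inl, ?_, by simp⟩
    ⟨biprod.desc S.f s.s, biprod.lift s.r S.g, ?_, by simp [s.id]⟩
    ⟨biprod.snd, biprod.inr, ?_, by simp⟩ ?_ ?_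
  · exact biprod.hom_ext _ _ (by simp) ((isZero_zero C).eq_of_tgt _ _)
  · apply biprod.hom_ext <;> apply biprod.hom_ext' <;> simp
  · exact biprod.hom_ext _ _ ((isZero_zero C).eq_of_tgt _ _) (by simp)
  · apply biprod.hom_ext' <;> simp
  · apply biprod.hom_ext' <;> simp

lemma exists_splitting_of_section {S : ShortComplex C} (h : 𝓔 S) (s : S.X₃ ⟶ S.X₂)
    (hs : s ≫ S.g = 𝟙 _) : Nonempty S.Splitting := by
  have := mono_f h
  obtain ⟨r, hr⟩ := exists_lift h (𝟙 _ - S.g ≫ s) (by simp [hs])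
  exact ⟨⟨r, s, by simp [← cancel_mono S.f, hr], hs, by simp [hr]⟩⟩

lemma exists_splitting_of_retraction {S : ShortComplex C} (h : 𝓔 S) (r : S.X₂ ⟶ S.X₁)
    (hr : S.f ≫ r = 𝟙 _) : Nonempty S.Splitting := by
  have := epi_g h
  obtain ⟨s, hs⟩ := exists_desc h (𝟙 _ - r ≫ S.f) (by simp [reassoc_of% hr])
  exact ⟨⟨r, s, hr, by simp [← cancel_epi S.g, reassoc_of% hs], by simp [hs]⟩⟩

/-- The obscure axiom for inflations: if `i` has a cokernel `p` and `i ≫ j` is an inflation, then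
`i` is an inflation. -/
lemma mem_of_isInflation_comp {S : ShortComplex C}
    (hc : Nonempty (IsColimit (CokernelCofork.ofπ S.g S.zero))) {Z : C} (j : S.X₂ ⟶ Z)
    (h : IsInflation 𝓔 (S.f ≫ j)) : 𝓔 S := by
  have : Epi S.g := Cofork.IsColimit.epi hc.some
  let e : S.X₂ ⊞ S.X₁ ≅ S.X₂ ⊞ S.X₁ :=
    ⟨biprod.lift (biprod.fst + biprod.snd ≫ S.f) biprod.snd,
      biprod.lift (biprod.fst - biprod.snd ≫ S.f) biprod.snd, by
        apply biprod.hom_ext' <;> apply biprod.hom_ext <;> simp, by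
        apply biprod.hom_ext' <;> apply biprod.hom_ext <;> simp⟩
  let e' : S.X₂ ⊞ Z ≅ S.X₂ ⊞ Z :=
    ⟨biprod.lift biprod.fst (biprod.snd - biprod.fst ≫ j),
      biprod.lift biprod.fst (biprod.snd + biprod.fst ≫ j), by
        apply biprod.hom_ext' <;> apply biprod.hom_ext <;> simp, by
        apply biprod.hom_ext' <;> apply biprod.hom_ext <;> simp⟩
  have h₁ : IsInflation 𝓔 (biprod.inr : S.X₁ ⟶ S.X₂ ⊞ S.X₁) :=
    isInflation (S := ShortComplex.mk biprod.inr biprod.fst (by simp))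
      (mem_of_splitting ⟨biprod.snd, biprod.inl, by simp, by simp, by
        apply biprod.hom_ext' <;> apply biprod.hom_ext <;> simp⟩)
  -- On elements, x ↦ (0, x) ↦ (f x, x) ↦ (f x, j f x) ↦ (f x, 0): the two shears turn the inflation
  -- `S.f ≫ j` into an inflation `S.f ≫ biprod.inl`.
  have h₂ := (inflation_comp _ _ (h₁.comp_iso 𝓔 e) (h.id_biprod_map 𝓔 S.X₂)).comp_iso 𝓔 e'
  have h₃ : ((biprod.inr ≫ e.hom) ≫ biprod.map (𝟙 S.X₂) (S.f ≫ j)) ≫ e'.hom =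
      S.f ≫ biprod.inl := by
    apply biprod.hom_ext <;> simp [e, e']
  rw [h₃] at h₂
  let T : ShortComplex C := ShortComplex.mk (S.f ≫ biprod.inl : S.X₁ ⟶ S.X₂ ⊞ Z)
    (biprod.map S.g (𝟙 Z)) (by simp)
  have hT : 𝓔 T := by
    refine mem_of_isInflation h₂ (nonempty_isColimit_cokernelCofork _ (fun a b hab ↦ ?_)
      (fun k hk ↦ ?_))
    · apply biprod.hom_ext'
      · have := biprod.inl ≫= hab
        simpa [T, cancel_epi] using this
      · simpa [T] using biprod.inr ≫= hab
    · obtain ⟨l, hl⟩ := CokernelCofork.IsColimit.desc' hc.some (biprod.inl ≫ k) (by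
        simpa [T] using hk)
      refine ⟨biprod.desc l (biprod.inr ≫ k), ?_⟩
      dsimp at hl
      apply biprod.hom_ext' <;> simp [T, hl]
  -- Pulling back along `S.X₃ ⟶ S.X₃ ⊞ Z` discards the superfluous summand Z and leaves S.
  have sq : IsPullback (biprod.inl : S.X₂ ⟶ S.X₂ ⊞ Z) S.g T.g (biprod.inl : S.X₃ ⟶ S.X₃ ⊞ Z) := by
    refine isPullback_of_exists_lift (by simp [T]) (fun a b h₁ _ ↦ ?_) (fun a b hab ↦ ?_)
    · simpa using h₁ =≫ biprod.fst
    · refine ⟨a ≫ biprod.fst, ?_, ?_⟩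
      · apply biprod.hom_ext
        · simp
        · simpa [T] using (hab =≫ biprod.snd).symm
      · simpa [T] using hab =≫ biprod.fst
  exact mem_of_isPullback hT sq S.zero rfl

/-- The obscure axiom for deflations: if `p` has a kernel `i` and `q ≫ p` is a deflation, then
`p` is a deflation. -/
lemma mem_of_isDeflation_comp {S : ShortComplex C}
    (hk : Nonempty (IsLimit (KernelFork.ofι S.f S.zero))) {Z : C} (q : Z ⟶ S.X₂)
    (h : IsDeflation 𝓔 (q ≫ S.g)) : 𝓔 S := by
  have : Mono S.f := Fork.IsLimit.mono hk.some
  let e : S.X₂ ⊞ S.X₃ ≅ S.X₂ ⊞ S.X₃ :=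
    ⟨biprod.lift biprod.fst (biprod.snd + biprod.fst ≫ S.g),
      biprod.lift biprod.fst (biprod.snd - biprod.fst ≫ S.g), by
        apply biprod.hom_ext' <;> apply biprod.hom_ext <;> simp, by
        apply biprod.hom_ext' <;> apply biprod.hom_ext <;> simp⟩
  let e' : S.X₂ ⊞ Z ≅ S.X₂ ⊞ Z :=
    ⟨biprod.lift (biprod.fst - biprod.snd ≫ q) biprod.snd,
      biprod.lift (biprod.fst + biprod.snd ≫ q) biprod.snd, by
        apply biprod.hom_ext' <;> apply biprod.hom_ext <;> simp, by
        apply biprod.hom_ext' <;> apply biprod.hom_ext <;> simp⟩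
  have h₁ : IsDeflation 𝓔 (biprod.snd : S.X₂ ⊞ S.X₃ ⟶ S.X₃) :=
    isDeflation (S := ShortComplex.mk biprod.inl biprod.snd (by simp))
      (mem_of_splitting ⟨biprod.fst, biprod.inr, by simp, by simp, by
        apply biprod.hom_ext' <;> apply biprod.hom_ext <;> simp⟩)
  have h₀ : IsDeflation 𝓔 (biprod.map (𝟙 S.X₂) (q ≫ S.g)) := by
    obtain ⟨K, k, w, h⟩ := h
    exact isDeflation (biprodSeq_mem 𝓔 (mem_zero_id 𝓔 (isZero_zero C) S.X₂) h)
  -- On elements, (x, z) ↦ (x - q z, z) ↦ (x - q z, g q z) ↦ g q z + g (x - q z) = g x.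
  have h₂ := isDeflation_iso_comp e' (deflation_comp _ _ h₀ (isDeflation_iso_comp e h₁))
  have h₃ : e'.hom ≫ biprod.map (𝟙 S.X₂) (q ≫ S.g) ≫ e.hom ≫ biprod.snd =
      biprod.fst ≫ S.g := by
    apply biprod.hom_ext' <;> simp [e, e']
  rw [h₃] at h₂
  let T : ShortComplex C := ShortComplex.mk (biprod.map S.f (𝟙 Z))
    (biprod.fst ≫ S.g : S.X₂ ⊞ Z ⟶ S.X₃) (by simp)
  have hT : 𝓔 T := by
    refine mem_of_isDeflation h₂ (nonempty_isLimit_kernelFork _ (fun a b hab ↦ ?_)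
      (fun k hk' ↦ ?_))
    · apply biprod.hom_ext
      · have := hab =≫ biprod.fst
        simpa [T, ← cancel_mono S.f] using this
      · simpa [T] using hab =≫ biprod.snd
    · obtain ⟨l, hl⟩ := KernelFork.IsLimit.lift' hk.some (k ≫ biprod.fst) (by
        simpa [T] using hk')
      refine ⟨biprod.lift l (k ≫ biprod.snd), ?_⟩
      dsimp at hl
      apply biprod.hom_ext <;> simp [T, hl]
  have sq : IsPushout T.f (biprod.fst : S.X₁ ⊞ Z ⟶ S.X₁) (biprod.fst : S.X₂ ⊞ Z ⟶ S.X₂) S.f := by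
    refine isPushout_of_exists_desc (by simp [T]) (fun a b h₁ _ ↦ ?_) (fun a b hab ↦ ?_)
    · simpa using biprod.inl ≫= h₁
    · refine ⟨biprod.inl ≫ a, ?_, ?_⟩
      · apply biprod.hom_ext'
        · simp
        · simpa [T] using (biprod.inr ≫= hab).symm
      · simpa [T] using biprod.inl ≫= hab
  exact mem_of_isPushout hT sq S.zero rfl

end IsExactStructure

/-! ### The degreewise exact structure on all complexes -/

section Complexes

variable {M : Type u} [Category.{v} M] [Preadditive M]

lemma isPullback_of_degreewise {P X Y Z : ShortComplex M} {fst : P ⟶ X} {snd : P ⟶ Y} {f : X ⟶ Z}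
    {g : Y ⟶ Z} (h₁ : IsPullback fst.τ₁ snd.τ₁ f.τ₁ g.τ₁)
    (h₂ : IsPullback fst.τ₂ snd.τ₂ f.τ₂ g.τ₂) (h₃ : IsPullback fst.τ₃ snd.τ₃ f.τ₃ g.τ₃) :
    IsPullback fst snd f g := by
  refine isPullback_of_exists_lift (ShortComplex.hom_ext _ _ h₁.w h₂.w h₃.w)
    (fun a b e e' ↦ ?_) (fun {T} a b hab ↦ ?_)
  · exact ShortComplex.hom_ext _ _
      (h₁.hom_ext (congrArg ShortComplex.Hom.τ₁ e) (congrArg ShortComplex.Hom.τ₁ e'))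
      (h₂.hom_ext (congrArg ShortComplex.Hom.τ₂ e) (congrArg ShortComplex.Hom.τ₂ e'))
      (h₃.hom_ext (congrArg ShortComplex.Hom.τ₃ e) (congrArg ShortComplex.Hom.τ₃ e'))
  · obtain ⟨l₁, e₁, e₁'⟩ := h₁.exists_lift a.τ₁ b.τ₁ (congrArg ShortComplex.Hom.τ₁ hab)
    obtain ⟨l₂, e₂, e₂'⟩ := h₂.exists_lift a.τ₂ b.τ₂ (congrArg ShortComplex.Hom.τ₂ hab)
    obtain ⟨l₃, e₃, e₃'⟩ := h₃.exists_lift a.τ₃ b.τ₃ (congrArg ShortComplex.Hom.τ₃ hab)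
    let l : T ⟶ P := ⟨l₁, l₂, l₃,
      h₂.hom_ext (by simp [← fst.comm₁₂, e₂, reassoc_of% e₁, a.comm₁₂])
        (by simp [← snd.comm₁₂, e₂', reassoc_of% e₁', b.comm₁₂]),
      h₃.hom_ext (by simp [← fst.comm₂₃, e₃, reassoc_of% e₂, a.comm₂₃])
        (by simp [← snd.comm₂₃, e₃', reassoc_of% e₂', b.comm₂₃])⟩
    exact ⟨l, ShortComplex.hom_ext _ _ e₁ e₂ e₃, ShortComplex.hom_ext _ _ e₁' e₂' e₃'⟩

lemma isPushout_of_degreewise {P X Y Z : ShortComplex M} {f : Z ⟶ X} {g : Z ⟶ Y} {inl : X ⟶ P}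
    {inr : Y ⟶ P} (h₁ : IsPushout f.τ₁ g.τ₁ inl.τ₁ inr.τ₁)
    (h₂ : IsPushout f.τ₂ g.τ₂ inl.τ₂ inr.τ₂) (h₃ : IsPushout f.τ₃ g.τ₃ inl.τ₃ inr.τ₃) :
    IsPushout f g inl inr := by
  refine isPushout_of_exists_desc (ShortComplex.hom_ext _ _ h₁.w h₂.w h₃.w)
    (fun a b e e' ↦ ?_) (fun {T} a b hab ↦ ?_)
  · exact ShortComplex.hom_ext _ _
      (h₁.hom_ext (congrArg ShortComplex.Hom.τ₁ e) (congrArg ShortComplex.Hom.τ₁ e'))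
      (h₂.hom_ext (congrArg ShortComplex.Hom.τ₂ e) (congrArg ShortComplex.Hom.τ₂ e'))
      (h₃.hom_ext (congrArg ShortComplex.Hom.τ₃ e) (congrArg ShortComplex.Hom.τ₃ e'))
  · obtain ⟨l₁, e₁, e₁'⟩ := h₁.exists_desc a.τ₁ b.τ₁ (congrArg ShortComplex.Hom.τ₁ hab)
    obtain ⟨l₂, e₂, e₂'⟩ := h₂.exists_desc a.τ₂ b.τ₂ (congrArg ShortComplex.Hom.τ₂ hab)
    obtain ⟨l₃, e₃, e₃'⟩ := h₃.exists_desc a.τ₃ b.τ₃ (congrArg ShortComplex.Hom.τ₃ hab)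
    let l : P ⟶ T := ⟨l₁, l₂, l₃,
      h₁.hom_ext (by simp [inl.comm₁₂_assoc, e₂, reassoc_of% e₁, a.comm₁₂])
        (by simp [inr.comm₁₂_assoc, e₂', reassoc_of% e₁', b.comm₁₂]),
      h₂.hom_ext (by simp [inl.comm₂₃_assoc, e₃, reassoc_of% e₂, a.comm₂₃])
        (by simp [inr.comm₂₃_assoc, e₃', reassoc_of% e₂', b.comm₂₃])⟩
    exact ⟨l, ShortComplex.hom_ext _ _ e₁ e₂ e₃, ShortComplex.hom_ext _ _ e₁' e₂' e₃'⟩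

/-- The class of short sequences of complexes which belong to `𝓔` in each degree. -/
def degreewiseComplex (𝓔 : ObjectProperty (ShortComplex M)) :
    ObjectProperty (ShortComplex (ShortComplex M)) :=
  fun S ↦ 𝓔 (S.map ShortComplex.π₁) ∧ 𝓔 (S.map ShortComplex.π₂) ∧ 𝓔 (S.map ShortComplex.π₃)

variable [HasZeroObject M] [HasBinaryBiproducts M]

open ZeroObject in
instance : HasZeroObject (ShortComplex M) :=
  ⟨⟨ShortComplex.mk (0 : (0 : M) ⟶ 0) (0 : (0 : M) ⟶ 0) (by simp), by
    rw [IsZero.iff_id_eq_zero]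
    exact ShortComplex.hom_ext _ _ ((isZero_zero M).eq_of_src _ _)
      ((isZero_zero M).eq_of_src _ _) ((isZero_zero M).eq_of_src _ _)⟩⟩

instance : HasBinaryBiproducts (ShortComplex M) where
  has_binary_biproduct X Y := by
    let b : BinaryBicone X Y :=
      { pt := biprodSeq X Y
        fst := ⟨biprod.fst, biprod.fst, biprod.fst, by simp, by simp⟩
        snd := ⟨biprod.snd, biprod.snd, biprod.snd, by simp, by simp⟩
        inl := ⟨biprod.inl, biprod.inl, biprod.inl, by simp, by simp⟩
        inr := ⟨biprod.inr, biprod.inr, biprod.inr, by simp, by simp⟩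
        inl_fst := by apply ShortComplex.hom_ext <;> simp
        inl_snd := by apply ShortComplex.hom_ext <;> simp
        inr_fst := by apply ShortComplex.hom_ext <;> simp
        inr_snd := by apply ShortComplex.hom_ext <;> simp }
    exact ⟨⟨b, isBinaryBilimitOfTotal b
      (ShortComplex.hom_ext _ _ biprod.total biprod.total biprod.total)⟩⟩

variable {𝓔 : ObjectProperty (ShortComplex M)} [IsExactStructure 𝓔]

open IsExactStructure

/-- The cokernels in the three degrees assemble into a complex by functoriality. Admissibility is
thus a condition in each degree, which reduces the axioms for complexes to those of `𝓔`. -/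
lemma isInflation_degreewiseComplex_iff {X Y : ShortComplex M} (f : X ⟶ Y) :
    IsInflation (degreewiseComplex 𝓔) f ↔
      IsInflation 𝓔 f.τ₁ ∧ IsInflation 𝓔 f.τ₂ ∧ IsInflation 𝓔 f.τ₃ := by
  refine ⟨?_, ?_⟩
  · rintro ⟨Z, p, w, h₁, h₂, h₃⟩
    exact ⟨isInflation h₁, isInflation h₂, isInflation h₃⟩
  · rintro ⟨⟨Z₁, p₁, w₁, h₁⟩, ⟨Z₂, p₂, w₂, h₂⟩, ⟨Z₃, p₃, w₃, h₃⟩⟩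
    obtain ⟨a, ha⟩ := exists_desc h₁ (Y.f ≫ p₂) (by simp [f.comm₁₂_assoc, w₂])
    obtain ⟨b, hb⟩ := exists_desc h₂ (Y.g ≫ p₃) (by simp [f.comm₂₃_assoc, w₃])
    dsimp at a b ha hb
    have : Epi p₁ := epi_g h₁
    let Z : ShortComplex M := ShortComplex.mk a b
      (by rw [← cancel_epi p₁, reassoc_of% ha, hb, Y.zero_assoc, zero_comp, comp_zero])
    let p : Y ⟶ Z := ⟨p₁, p₂, p₃, ha, hb⟩
    exact ⟨Z, p, ShortComplex.hom_ext _ _ w₁ w₂ w₃, h₁, h₂, h₃⟩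

lemma isDeflation_degreewiseComplex_iff {Y Z : ShortComplex M} (f : Y ⟶ Z) :
    IsDeflation (degreewiseComplex 𝓔) f ↔
      IsDeflation 𝓔 f.τ₁ ∧ IsDeflation 𝓔 f.τ₂ ∧ IsDeflation 𝓔 f.τ₃ := by
  refine ⟨?_, ?_⟩
  · rintro ⟨X, i, w, h₁, h₂, h₃⟩
    exact ⟨isDeflation h₁, isDeflation h₂, isDeflation h₃⟩
  · rintro ⟨⟨X₁, i₁, w₁, h₁⟩, ⟨X₂, i₂, w₂, h₂⟩, ⟨X₃, i₃, w₃, h₃⟩⟩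
    obtain ⟨a, ha⟩ := exists_lift h₂ (i₁ ≫ Y.f) (by simp [← f.comm₁₂, reassoc_of% w₁])
    obtain ⟨b, hb⟩ := exists_lift h₃ (i₂ ≫ Y.g) (by simp [← f.comm₂₃, reassoc_of% w₂])
    dsimp at a b ha hb
    have : Mono i₃ := mono_f h₃
    let X : ShortComplex M := ShortComplex.mk a b
      (by rw [← cancel_mono i₃, Category.assoc, hb, reassoc_of% ha, Y.zero, zero_comp, comp_zero])
    let i : X ⟶ Y := ⟨i₁, i₂, i₃, ha.symm, hb.symm⟩
    exact ⟨X, i, ShortComplex.hom_ext _ _ w₁ w₂ w₃, h₁, h₂, h₃⟩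

instance : IsExactStructure (degreewiseComplex 𝓔) where
  of_iso e h := ⟨of_iso (ShortComplex.π₁.mapShortComplex.mapIso e) h.1,
    of_iso (ShortComplex.π₂.mapShortComplex.mapIso e) h.2.1,
    of_iso (ShortComplex.π₃.mapShortComplex.mapIso e) h.2.2⟩
  isKernel := by
    rintro S ⟨h₁, h₂, h₃⟩
    have m₁ : Mono S.f.τ₁ := mono_f h₁
    have m₂ : Mono S.f.τ₂ := mono_f h₂
    have m₃ : Mono S.f.τ₃ := mono_f h₃
    refine nonempty_isLimit_kernelFork _ (fun a b hab ↦ ?_) (fun {T} k hk ↦ ?_)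
    · exact ShortComplex.hom_ext _ _
        ((cancel_mono S.f.τ₁).1 (congrArg ShortComplex.Hom.τ₁ hab))
        ((cancel_mono S.f.τ₂).1 (congrArg ShortComplex.Hom.τ₂ hab))
        ((cancel_mono S.f.τ₃).1 (congrArg ShortComplex.Hom.τ₃ hab))
    · obtain ⟨l₁, e₁⟩ : ∃ l : T.X₁ ⟶ S.X₁.X₁, l ≫ S.f.τ₁ = k.τ₁ :=
        exists_lift h₁ k.τ₁ (congrArg ShortComplex.Hom.τ₁ hk)
      obtain ⟨l₂, e₂⟩ : ∃ l : T.X₂ ⟶ S.X₁.X₂, l ≫ S.f.τ₂ = k.τ₂ :=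
        exists_lift h₂ k.τ₂ (congrArg ShortComplex.Hom.τ₂ hk)
      obtain ⟨l₃, e₃⟩ : ∃ l : T.X₃ ⟶ S.X₁.X₃, l ≫ S.f.τ₃ = k.τ₃ :=
        exists_lift h₃ k.τ₃ (congrArg ShortComplex.Hom.τ₃ hk)
      let l : T ⟶ S.X₁ := ⟨l₁, l₂, l₃,
        by rw [← cancel_mono S.f.τ₂, Category.assoc, Category.assoc, ← S.f.comm₁₂, e₂,
          reassoc_of% e₁, k.comm₁₂],
        by rw [← cancel_mono S.f.τ₃, Category.assoc, Category.assoc, ← S.f.comm₂₃, e₃,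
          reassoc_of% e₂, k.comm₂₃]⟩
      exact ⟨l, ShortComplex.hom_ext _ _ e₁ e₂ e₃⟩
  isCokernel := by
    rintro S ⟨h₁, h₂, h₃⟩
    have m₁ : Epi S.g.τ₁ := epi_g h₁
    have m₂ : Epi S.g.τ₂ := epi_g h₂
    have m₃ : Epi S.g.τ₃ := epi_g h₃
    refine nonempty_isColimit_cokernelCofork _ (fun a b hab ↦ ?_) (fun {T} k hk ↦ ?_)
    · exact ShortComplex.hom_ext _ _
        ((cancel_epi S.g.τ₁).1 (congrArg ShortComplex.Hom.τ₁ hab))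
        ((cancel_epi S.g.τ₂).1 (congrArg ShortComplex.Hom.τ₂ hab))
        ((cancel_epi S.g.τ₃).1 (congrArg ShortComplex.Hom.τ₃ hab))
    · obtain ⟨l₁, e₁⟩ : ∃ l : S.X₃.X₁ ⟶ T.X₁, S.g.τ₁ ≫ l = k.τ₁ :=
        exists_desc h₁ k.τ₁ (congrArg ShortComplex.Hom.τ₁ hk)
      obtain ⟨l₂, e₂⟩ : ∃ l : S.X₃.X₂ ⟶ T.X₂, S.g.τ₂ ≫ l = k.τ₂ :=
        exists_desc h₂ k.τ₂ (congrArg ShortComplex.Hom.τ₂ hk)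
      obtain ⟨l₃, e₃⟩ : ∃ l : S.X₃.X₃ ⟶ T.X₃, S.g.τ₃ ≫ l = k.τ₃ :=
        exists_desc h₃ k.τ₃ (congrArg ShortComplex.Hom.τ₃ hk)
      let l : S.X₃ ⟶ T := ⟨l₁, l₂, l₃,
        by rw [← cancel_epi S.g.τ₁, S.g.comm₁₂_assoc, e₂, reassoc_of% e₁, k.comm₁₂],
        by rw [← cancel_epi S.g.τ₂, S.g.comm₂₃_assoc, e₃, reassoc_of% e₂, k.comm₂₃]⟩
      exact ⟨l, ShortComplex.hom_ext _ _ e₁ e₂ e₃⟩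
  inflation_id X := (isInflation_degreewiseComplex_iff _).2
    ⟨inflation_id _, inflation_id _, inflation_id _⟩
  deflation_id X := (isDeflation_degreewiseComplex_iff _).2
    ⟨deflation_id _, deflation_id _, deflation_id _⟩
  inflation_comp i j hi hj := by
    rw [isInflation_degreewiseComplex_iff] at hi hj ⊢
    exact ⟨inflation_comp _ _ hi.1 hj.1, inflation_comp _ _ hi.2.1 hj.2.1,
      inflation_comp _ _ hi.2.2 hj.2.2⟩
  deflation_comp p q hp hq := by
    rw [isDeflation_degreewiseComplex_iff] at hp hq ⊢
    exact ⟨deflation_comp _ _ hp.1 hq.1, deflation_comp _ _ hp.2.1 hq.2.1,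
      deflation_comp _ _ hp.2.2 hq.2.2⟩
  exists_pushout {X Y X'} i f hi := by
    rw [isInflation_degreewiseComplex_iff] at hi
    obtain ⟨Y₁, f₁, i₁, sq₁, hi₁⟩ := exists_pushout i.τ₁ f.τ₁ hi.1
    obtain ⟨Y₂, f₂, i₂, sq₂, hi₂⟩ := exists_pushout i.τ₂ f.τ₂ hi.2.1
    obtain ⟨Y₃, f₃, i₃, sq₃, hi₃⟩ := exists_pushout i.τ₃ f.τ₃ hi.2.2
    obtain ⟨a, fa, ia⟩ := sq₁.exists_desc (Y.f ≫ f₂) (X'.f ≫ i₂)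
      (by rw [i.comm₁₂_assoc, sq₂.w, f.comm₁₂_assoc])
    obtain ⟨b, fb, ib⟩ := sq₂.exists_desc (Y.g ≫ f₃) (X'.g ≫ i₃)
      (by rw [i.comm₂₃_assoc, sq₃.w, f.comm₂₃_assoc])
    let Y' : ShortComplex M := ShortComplex.mk a b (sq₁.hom_ext (by simp [reassoc_of% fa, fb])
      (by simp [reassoc_of% ia, ib]))
    let f' : Y ⟶ Y' := ⟨f₁, f₂, f₃, fa, fb⟩
    let i' : X' ⟶ Y' := ⟨i₁, i₂, i₃, ia, ib⟩
    exact ⟨Y', f', i', isPushout_of_degreewise sq₁ sq₂ sq₃,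
      (isInflation_degreewiseComplex_iff _).2 ⟨hi₁, hi₂, hi₃⟩⟩
  exists_pullback {Y Z Z'} p f hp := by
    rw [isDeflation_degreewiseComplex_iff] at hp
    obtain ⟨Y₁, f₁, p₁, sq₁, hp₁⟩ := exists_pullback p.τ₁ f.τ₁ hp.1
    obtain ⟨Y₂, f₂, p₂, sq₂, hp₂⟩ := exists_pullback p.τ₂ f.τ₂ hp.2.1
    obtain ⟨Y₃, f₃, p₃, sq₃, hp₃⟩ := exists_pullback p.τ₃ f.τ₃ hp.2.2
    obtain ⟨a, fa, pa⟩ := sq₂.exists_lift (f₁ ≫ Y.f) (p₁ ≫ Z'.f)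
      (by rw [Category.assoc, ← p.comm₁₂, sq₁.w_assoc, f.comm₁₂, Category.assoc])
    obtain ⟨b, fb, pb⟩ := sq₃.exists_lift (f₂ ≫ Y.g) (p₂ ≫ Z'.g)
      (by rw [Category.assoc, ← p.comm₂₃, sq₂.w_assoc, f.comm₂₃, Category.assoc])
    let Y' : ShortComplex M := ShortComplex.mk a b (sq₃.hom_ext (by simp [reassoc_of% fa, fb])
      (by simp [reassoc_of% pa, pb]))
    let f' : Y' ⟶ Y := ⟨f₁, f₂, f₃, fa.symm, fb.symm⟩
    let p' : Y' ⟶ Z' := ⟨p₁, p₂, p₃, pa.symm, pb.symm⟩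
    exact ⟨Y', f', p', isPullback_of_degreewise sq₁ sq₂ sq₃,
      (isDeflation_degreewiseComplex_iff _).2 ⟨hp₁, hp₂, hp₃⟩⟩

end Complexes

/-! ### Restriction to extension-closed subcategories -/

section FullSubcategory

open IsExactStructure

variable {C : Type u} [Category.{v} C] [Preadditive C] [HasZeroObject C] [HasBinaryBiproducts C]
  (𝓔 : ObjectProperty (ShortComplex C)) [IsExactStructure 𝓔] (P : ObjectProperty C)
  [HasZeroObject P.FullSubcategory] [HasBinaryBiproducts P.FullSubcategory]

open ZeroObject in
/-- An extension-closed full subcategory of an exact category is exact. -/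
lemma isExactStructure_fullSubcategory
    (hP : ∀ {S : ShortComplex C}, 𝓔 S → P S.X₁ → P S.X₃ → P S.X₂) :
    IsExactStructure (fun S : ShortComplex P.FullSubcategory ↦ 𝓔 (S.map P.ι)) where
  of_iso e h := of_iso (P.ι.mapShortComplex.mapIso e) h
  isKernel {S} h := by
    have : Mono S.f.hom := mono_f h
    refine nonempty_isLimit_kernelFork _ (fun a b hab ↦ ?_) (fun {T} k hk ↦ ?_)
    · ext
      exact (cancel_mono S.f.hom).1 (congrArg InducedCategory.Hom.hom hab)
    · obtain ⟨l, hl⟩ := exists_lift h k.hom (congrArg InducedCategory.Hom.hom hk)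
      exact ⟨ObjectProperty.homMk l, ObjectProperty.hom_ext _ hl⟩
  isCokernel {S} h := by
    have : Epi S.g.hom := epi_g h
    refine nonempty_isColimit_cokernelCofork _ (fun a b hab ↦ ?_) (fun {T} k hk ↦ ?_)
    · ext
      exact (cancel_epi S.g.hom).1 (congrArg InducedCategory.Hom.hom hab)
    · obtain ⟨l, hl⟩ := exists_desc h k.hom (congrArg InducedCategory.Hom.hom hk)
      exact ⟨ObjectProperty.homMk l, ObjectProperty.hom_ext _ hl⟩
  inflation_id X := ⟨0, 0, by simp, mem_id_zero 𝓔 X.obj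
    ((IsZero.iff_id_eq_zero _).2 (congrArg InducedCategory.Hom.hom
      ((isZero_zero P.FullSubcategory).eq_of_src (𝟙 0) 0)))⟩
  deflation_id X := ⟨0, 0, by simp, mem_zero_id 𝓔
    ((IsZero.iff_id_eq_zero _).2 (congrArg InducedCategory.Hom.hom
      ((isZero_zero P.FullSubcategory).eq_of_src (𝟙 0) 0))) X.obj⟩
  inflation_comp := by
    rintro X Y Z i j ⟨A, p, w, h⟩ ⟨B, q, w', h'⟩
    -- The cokernel of the composite is an extension of the two given cokernels, hence lies in `P`.
    obtain ⟨D, c, a, b, w₁, w₂, hc, hab, -, -⟩ := exists_mem_comp_inflation _ _ h h'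
    exact ⟨⟨D, hP hab A.property B.property⟩, ObjectProperty.homMk c,
      ObjectProperty.hom_ext _ w₁, hc⟩
  deflation_comp := by
    rintro X Y Z p q ⟨A, i, w, h⟩ ⟨B, j, w', h'⟩
    obtain ⟨D, c, a, b, w₁, w₂, hc, hab, -, -⟩ := exists_mem_comp_deflation _ _ h h'
    exact ⟨⟨D, hP hab A.property B.property⟩, ObjectProperty.homMk c,
      ObjectProperty.hom_ext _ w₁, hc⟩
  exists_pushout := by
    rintro X Y X' i f ⟨A, p, w, h⟩
    obtain ⟨Y', f', i', p', w', sq, -, h'⟩ := exists_mem_isPushout h f.hom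
    let Y'' : P.FullSubcategory := ⟨Y', hP h' X'.property A.property⟩
    let f'' : Y ⟶ Y'' := ObjectProperty.homMk f'
    let i'' : X' ⟶ Y'' := ObjectProperty.homMk i'
    exact ⟨Y'', f'', i'', IsPushout.of_map_of_faithful P.ι sq,
      ⟨A, ObjectProperty.homMk p', ObjectProperty.hom_ext _ w', h'⟩⟩
  exists_pullback := by
    rintro Y Z Z' p f ⟨A, i, w, h⟩
    obtain ⟨Y', f', i', p', w', sq, -, h'⟩ := exists_mem_isPullback h f.hom
    let Y'' : P.FullSubcategory := ⟨Y', hP h' A.property Z'.property⟩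
    let f'' : Y'' ⟶ Y := ObjectProperty.homMk f'
    let p'' : Y'' ⟶ Z' := ObjectProperty.homMk p'
    exact ⟨Y'', f'', p'', IsPullback.of_map_of_faithful P.ι sq,
      ⟨A, ObjectProperty.homMk i', ObjectProperty.hom_ext _ w', h'⟩⟩

end FullSubcategory

/-! ### Conflations that split after a functor -/

section SplitSubstructure

open IsExactStructure

variable {C : Type u} [Category.{v} C] [Preadditive C] [HasZeroObject C] [HasBinaryBiproducts C]
  {M : Type*} [Category* M] [Preadditive M] [HasZeroObject M] [HasBinaryBiproducts M]
  (𝓓 : ObjectProperty (ShortComplex C)) [IsExactStructure 𝓓]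
  (𝓔 : ObjectProperty (ShortComplex M)) [IsExactStructure 𝓔]
  (F : C ⥤ M) [F.Additive]

variable {𝓔 F} in
omit [HasZeroObject C] [HasBinaryBiproducts C] in
-- Each exactness axiom carries along one kind of splitting datum: sections survive pushouts and
-- composites of deflations, retractions survive pullbacks and composites of inflations.
lemma nonempty_splitting_map_iff_section {X Y Z : C} {i : X ⟶ Y} {p : Y ⟶ Z} {w : i ≫ p = 0}
    (h : 𝓔 ((ShortComplex.mk i p w).map F)) :
    Nonempty ((ShortComplex.mk i p w).map F).Splitting ↔
      ∃ s : F.obj Z ⟶ F.obj Y, s ≫ F.map p = 𝟙 _ :=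
  ⟨fun ⟨s⟩ ↦ ⟨s.s, s.s_g⟩, fun ⟨s, hs⟩ ↦ exists_splitting_of_section h s hs⟩

variable {𝓔 F} in
omit [HasZeroObject C] [HasBinaryBiproducts C] in
lemma nonempty_splitting_map_iff_retraction {X Y Z : C} {i : X ⟶ Y} {p : Y ⟶ Z} {w : i ≫ p = 0}
    (h : 𝓔 ((ShortComplex.mk i p w).map F)) :
    Nonempty ((ShortComplex.mk i p w).map F).Splitting ↔
      ∃ r : F.obj Y ⟶ F.obj X, F.map i ≫ r = 𝟙 _ :=
  ⟨fun ⟨s⟩ ↦ ⟨s.r, s.f_r⟩, fun ⟨r, hr⟩ ↦ exists_splitting_of_retraction h r hr⟩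

/-- The conflations which become split after applying a functor which preserves conflations form
an exact substructure. -/
lemma isExactStructure_splitAfter (hF : ∀ {S : ShortComplex C}, 𝓓 S → 𝓔 (S.map F)) :
    IsExactStructure (fun S : ShortComplex C ↦ 𝓓 S ∧ Nonempty (S.map F).Splitting) where
  of_iso e h := ⟨of_iso e h.1, h.2.map fun s ↦ s.ofIso (F.mapShortComplex.mapIso e)⟩
  isKernel h := isKernel h.1
  isCokernel h := isCokernel h.1
  inflation_id X := by
    obtain ⟨Z, p, w, h⟩ := inflation_id (𝓔 := 𝓓) X
    exact ⟨Z, p, w, h, (nonempty_splitting_map_iff_retraction (hF h)).2 ⟨𝟙 _, by simp⟩⟩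
  deflation_id X := by
    obtain ⟨Z, p, w, h⟩ := deflation_id (𝓔 := 𝓓) X
    exact ⟨Z, p, w, h, (nonempty_splitting_map_iff_section (hF h)).2 ⟨𝟙 _, by simp⟩⟩
  inflation_comp := by
    rintro X Y Z i j ⟨A, p, w, h, hs⟩ ⟨B, q, w', h', hs'⟩
    obtain ⟨D, c, hw, hc⟩ := inflation_comp i j (isInflation h) (isInflation h')
    obtain ⟨r, hr⟩ := (nonempty_splitting_map_iff_retraction (hF h)).1 hs
    obtain ⟨r', hr'⟩ := (nonempty_splitting_map_iff_retraction (hF h')).1 hs'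
    exact ⟨D, c, hw, hc, (nonempty_splitting_map_iff_retraction (hF hc)).2
      ⟨r' ≫ r, by simp [reassoc_of% hr', hr]⟩⟩
  deflation_comp := by
    rintro X Y Z p q ⟨A, i, w, h, hs⟩ ⟨B, j, w', h', hs'⟩
    obtain ⟨D, c, hw, hc⟩ := deflation_comp p q (isDeflation h) (isDeflation h')
    obtain ⟨s, hs⟩ := (nonempty_splitting_map_iff_section (hF h)).1 hs
    obtain ⟨s', hs'⟩ := (nonempty_splitting_map_iff_section (hF h')).1 hs'
    exact ⟨D, c, hw, hc, (nonempty_splitting_map_iff_section (hF hc)).2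
      ⟨s' ≫ s, by simp [reassoc_of% hs, hs']⟩⟩
  exists_pushout := by
    rintro X Y X' i f ⟨A, p, w, h, hs⟩
    obtain ⟨Y', f', i', p', w', sq, hp, h'⟩ := exists_mem_isPushout h f
    obtain ⟨s, hs⟩ := (nonempty_splitting_map_iff_section (hF h)).1 hs
    exact ⟨Y', f', i', sq, A, p', w', h', (nonempty_splitting_map_iff_section (hF h')).2
      ⟨s ≫ F.map f', by rw [Category.assoc, ← F.map_comp, hp, hs]⟩⟩
  exists_pullback := by
    rintro Y Z Z' p f ⟨A, i, w, h, hs⟩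
    obtain ⟨Y', f', i', p', w', sq, hi, h'⟩ := exists_mem_isPullback h f
    obtain ⟨r, hr⟩ := (nonempty_splitting_map_iff_retraction (hF h)).1 hs
    exact ⟨Y', f', p', sq, A, i', w', h', (nonempty_splitting_map_iff_retraction (hF h')).2
      ⟨F.map f' ≫ r, by rw [← Category.assoc, ← F.map_comp, hi, hr]⟩⟩

end SplitSubstructure

/-! ### The two exact structures on the category of conflations -/

section Conflations

open IsExactStructure

variable {M : Type u} [Category.{v} M] [Preadditive M] [HasZeroObject M] [HasBinaryBiproducts M]
  (𝓔 : ObjectProperty (ShortComplex M)) [IsExactStructure 𝓔]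

instance isExactStructure_degreewise : IsExactStructure (degreewise 𝓔) :=
  isExactStructure_fullSubcategory (degreewiseComplex 𝓔) 𝓔
    (fun h hA hC ↦ mem_of_extension h.1 h.2.1 h.2.2 hA hC)

instance isExactStructure_degreewiseMiddleSplit :
    IsExactStructure (degreewiseMiddleSplit 𝓔) :=
  have : (𝓔.ι ⋙ ShortComplex.π₂).Additive := { map_add := rfl }
  isExactStructure_splitAfter (degreewise 𝓔) 𝓔 (𝓔.ι ⋙ ShortComplex.π₂) (fun h ↦ h.2.1)

end Conflations

/-! ### Additivity of the quotient category -/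

namespace AdditiveQuotient

variable {C : Type u} [Category.{v} C] [Preadditive C] [HasZeroObject C] [HasBinaryBiproducts C]
  (P : ObjectProperty C)

/-- The quotient functor `C ⥤ C / P`. -/
abbrev functor : C ⥤ AdditiveQuotient P := Quotient.functor (factorsThroughRel P)

variable [IsAdditiveSubcategory P]

instance : (functor P).Additive where
  map_add := rfl

variable {P} in
lemma functor_map_eq_zero_iff {X Y : C} (f : X ⟶ Y) :
    (functor P).map f = 0 ↔ ∃ (W : C) (_ : P W) (a : X ⟶ W) (b : W ⟶ Y), f = a ≫ b := by
  rw [← (functor P).map_zero X Y, Quotient.functor_map_eq_iff]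
  simp [factorsThroughRel]

open ZeroObject in
instance : HasFiniteProducts (AdditiveQuotient P) := by
  have : HasZeroObject (AdditiveQuotient P) := by
    refine ⟨(functor P).obj (0 : C), ?_⟩
    rw [IsZero.iff_id_eq_zero, ← (functor P).map_id, (isZero_zero C).eq_of_src (𝟙 (0 : C)) 0,
      (functor P).map_zero]
  have : HasBinaryBiproducts (AdditiveQuotient P) := ⟨by
    rintro ⟨X⟩ ⟨Y⟩
    let b : BinaryBicone ((functor P).obj X) ((functor P).obj Y) :=
      { pt := (functor P).obj (X ⊞ Y)
        fst := (functor P).map biprod.fst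
        snd := (functor P).map biprod.snd
        inl := (functor P).map biprod.inl
        inr := (functor P).map biprod.inr
        inl_fst := by rw [← Functor.map_comp, biprod.inl_fst, CategoryTheory.Functor.map_id]
        inl_snd := by rw [← Functor.map_comp, biprod.inl_snd, Functor.map_zero]
        inr_fst := by rw [← Functor.map_comp, biprod.inr_fst, Functor.map_zero]
        inr_snd := by rw [← Functor.map_comp, biprod.inr_snd, CategoryTheory.Functor.map_id] }
    exact ⟨⟨b, isBinaryBilimitOfTotal b (by
      simp only [b, ← Functor.map_comp, ← Functor.map_add, biprod.total,
        CategoryTheory.Functor.map_id])⟩⟩⟩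
  exact hasFiniteProducts_of_has_binary_and_terminal

end AdditiveQuotient

/-! ### The quotient by split conflations is abelian -/

namespace ConflationCat

open IsExactStructure AdditiveQuotient

variable {M : Type u} [Category.{v} M] [Preadditive M] [HasZeroObject M] [HasBinaryBiproducts M]
  {𝓔 : ObjectProperty (ShortComplex M)} [IsExactStructure 𝓔]

lemma exists_hom_of_comm₁₂ {X Y : ConflationCat 𝓔} (a : X.obj.X₁ ⟶ Y.obj.X₁)
    (b : X.obj.X₂ ⟶ Y.obj.X₂) (h : a ≫ Y.obj.f = X.obj.f ≫ b) :
    ∃ f : X ⟶ Y, f.hom.τ₁ = a ∧ f.hom.τ₂ = b := by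
  obtain ⟨c, hc⟩ := exists_desc X.property (b ≫ Y.obj.g) (by simp [← reassoc_of% h])
  exact ⟨ObjectProperty.homMk ⟨a, b, c, h, hc.symm⟩, rfl, rfl⟩

lemma exists_hom_of_comm₂₃ {X Y : ConflationCat 𝓔} (b : X.obj.X₂ ⟶ Y.obj.X₂)
    (c : X.obj.X₃ ⟶ Y.obj.X₃) (h : b ≫ Y.obj.g = X.obj.g ≫ c) :
    ∃ f : X ⟶ Y, f.hom.τ₂ = b ∧ f.hom.τ₃ = c := by
  obtain ⟨a, ha⟩ := exists_lift Y.property (X.obj.f ≫ b) (by simp [h])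
  exact ⟨ObjectProperty.homMk ⟨a, b, c, ha, h⟩, rfl, rfl⟩

variable (𝓔) in
/-- The split conflation `A ⟶ A ⊞ B ⟶ B`. -/
noncomputable abbrev split (A B : M) : ConflationCat 𝓔 where
  obj := ShortComplex.mk (biprod.inl : A ⟶ A ⊞ B) biprod.snd (by simp)
  property := mem_of_splitting ⟨biprod.fst, biprod.inr, by simp, by simp, by simp⟩

lemma splitConflations_split (A B : M) : splitConflations 𝓔 (split 𝓔 A B) :=
  ⟨⟨biprod.fst, biprod.inr, by simp, by simp, by simp⟩⟩

/-- The canonical morphism from a split conflation to a conflation. -/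
@[simps!]
noncomputable def fromSplit (X : ConflationCat 𝓔) : split 𝓔 X.obj.X₁ X.obj.X₂ ⟶ X :=
  ObjectProperty.homMk ⟨𝟙 _, biprod.desc X.obj.f (𝟙 _), X.obj.g, by simp, by
    apply biprod.hom_ext' <;> simp⟩

/-- The canonical morphism from a conflation to a split conflation. -/
@[simps!]
noncomputable def toSplit (X : ConflationCat 𝓔) : X ⟶ split 𝓔 X.obj.X₂ X.obj.X₃ :=
  ObjectProperty.homMk ⟨X.obj.f, biprod.lift (𝟙 _) X.obj.g, 𝟙 _, by
    apply biprod.hom_ext <;> simp, by simp⟩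

variable {X Y Z : ConflationCat 𝓔}

/-- A splitting of W contracts it, so a factorization through W yields a null-homotopy. Conversely,
a null-homotopic map factors through `fromSplit Y`. -/
lemma map_eq_zero_iff_homotopy (f : X ⟶ Y) :
    (functor (splitConflations 𝓔)).map f = 0 ↔
      ∃ (h : X.obj.X₂ ⟶ Y.obj.X₁) (k : X.obj.X₃ ⟶ Y.obj.X₂), X.obj.f ≫ h = f.hom.τ₁ ∧
        h ≫ Y.obj.f + X.obj.g ≫ k = f.hom.τ₂ ∧ k ≫ Y.obj.g = f.hom.τ₃ := by
  rw [functor_map_eq_zero_iff]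
  refine ⟨?_, ?_⟩
  · rintro ⟨W, ⟨s⟩, a, b, rfl⟩
    refine ⟨a.hom.τ₂ ≫ s.r ≫ b.hom.τ₁, a.hom.τ₃ ≫ s.s ≫ b.hom.τ₂, ?_, ?_, ?_⟩
    · simp [← a.hom.comm₁₂_assoc]
    · have := a.hom.τ₂ ≫= (s.id =≫ b.hom.τ₂)
      simpa [← a.hom.comm₂₃_assoc, b.hom.comm₁₂] using this
    · simp [b.hom.comm₂₃]
  · rintro ⟨h, k, h₁, h₂, h₃⟩
    refine ⟨_, splitConflations_split Y.obj.X₁ Y.obj.X₂,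
      ObjectProperty.homMk ⟨f.hom.τ₁, biprod.lift h (X.obj.g ≫ k), k, ?_, ?_⟩, fromSplit Y, ?_⟩
    · apply biprod.hom_ext <;> simp [h₁]
    · simp
    · apply ObjectProperty.hom_ext
      apply ShortComplex.hom_ext <;> simp [h₂, h₃]

/-- Half of a homotopy determines the rest: `f.hom.τ₂ - h ≫ Y.obj.f` kills `X.obj.f`, and its
factorization through `X.obj.g` is the missing component. -/
lemma map_eq_zero_iff_left (f : X ⟶ Y) :
    (functor (splitConflations 𝓔)).map f = 0 ↔
      ∃ h : X.obj.X₂ ⟶ Y.obj.X₁, X.obj.f ≫ h = f.hom.τ₁ := by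
  rw [map_eq_zero_iff_homotopy]
  refine ⟨fun ⟨h, _, e, _⟩ ↦ ⟨h, e⟩, fun ⟨h, e⟩ ↦ ?_⟩
  have := epi_g X.property
  obtain ⟨k, hk⟩ := exists_desc X.property (f.hom.τ₂ - h ≫ Y.obj.f)
    (by simp [reassoc_of% e, f.hom.comm₁₂])
  refine ⟨h, k, e, by simp [hk], ?_⟩
  rw [← cancel_epi X.obj.g, reassoc_of% hk]
  simp [f.hom.comm₂₃]

lemma map_eq_zero_iff_right (f : X ⟶ Y) :
    (functor (splitConflations 𝓔)).map f = 0 ↔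
      ∃ k : X.obj.X₃ ⟶ Y.obj.X₂, k ≫ Y.obj.g = f.hom.τ₃ := by
  rw [map_eq_zero_iff_homotopy]
  refine ⟨fun ⟨_, k, _, _, e⟩ ↦ ⟨k, e⟩, fun ⟨k, e⟩ ↦ ?_⟩
  have := mono_f Y.property
  obtain ⟨h, hh⟩ := exists_lift Y.property (f.hom.τ₂ - X.obj.g ≫ k)
    (by simp [e, f.hom.comm₂₃])
  refine ⟨h, k, ?_, by simp [hh], e⟩
  rw [← cancel_mono Y.obj.f, Category.assoc, hh]
  simp [f.hom.comm₁₂]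

lemma map_eq_iff_left (f g : X ⟶ Y) :
    (functor (splitConflations 𝓔)).map f = (functor (splitConflations 𝓔)).map g ↔
      ∃ h : X.obj.X₂ ⟶ Y.obj.X₁, X.obj.f ≫ h = f.hom.τ₁ - g.hom.τ₁ := by
  rw [← sub_eq_zero, ← Functor.map_sub, map_eq_zero_iff_left]
  rfl

lemma map_eq_iff_right (f g : X ⟶ Y) :
    (functor (splitConflations 𝓔)).map f = (functor (splitConflations 𝓔)).map g ↔
      ∃ k : X.obj.X₃ ⟶ Y.obj.X₂, k ≫ Y.obj.g = f.hom.τ₃ - g.hom.τ₃ := by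
  rw [← sub_eq_zero, ← Functor.map_sub, map_eq_zero_iff_right]
  rfl

/-- Vanishing is detected on subobjects, where the invertible component can be cancelled from the
homotopy. -/
lemma mono_map (f : X ⟶ Y) [IsIso f.hom.τ₁] : Mono ((functor (splitConflations 𝓔)).map f) := by
  refine Preadditive.mono_of_cancel_zero _ ?_
  rintro ⟨T⟩ g hg
  obtain ⟨g, rfl⟩ := (functor (splitConflations 𝓔)).map_surjective (X := T) g
  rw [← Functor.map_comp, map_eq_zero_iff_left] at hg
  obtain ⟨h, hh⟩ := hg
  exact (map_eq_zero_iff_left g).2 ⟨h ≫ inv f.hom.τ₁, by simp [reassoc_of% hh]⟩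

lemma epi_map (f : X ⟶ Y) [IsIso f.hom.τ₃] : Epi ((functor (splitConflations 𝓔)).map f) := by
  refine Preadditive.epi_of_cancel_zero _ ?_
  rintro ⟨T⟩ g hg
  obtain ⟨g, rfl⟩ := (functor (splitConflations 𝓔)).map_surjective (X := Y) (Y := T) g
  rw [← Functor.map_comp, map_eq_zero_iff_right] at hg
  obtain ⟨k, hk⟩ := hg
  exact (map_eq_zero_iff_right g).2 ⟨inv f.hom.τ₃ ≫ k, by simp [hk]⟩

/-- A morphism of conflations which is an isomorphism on the quotient objects has a kernel in
the quotient category and is the cokernel of it. -/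
lemma exists_kernel (e : X ⟶ Z) [IsIso e.hom.τ₃] :
    ∃ (K : ConflationCat 𝓔) (κ : K ⟶ X) (w : (functor (splitConflations 𝓔)).map κ ≫
      (functor (splitConflations 𝓔)).map e = 0),
      Nonempty (IsLimit (KernelFork.ofι _ w)) ∧ Nonempty (IsColimit (CokernelCofork.ofπ _ w)) := by
  -- K is the cone conflation X₁ → X₂ ⊞ Z₁ → Z₂. Since `κ` is the identity on X₁ and `e` is
  -- invertible on quotient objects, `κ` becomes mono and `e` epi, so only existence of
  -- factorizations remains.
  let K : ConflationCat 𝓔 := ⟨_, biprod_mem_of_isIso_τ₃ X.property Z.property e.hom⟩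
  have sq := isPushout_of_isIso_τ₃ X.property Z.property e.hom
  let κ : K ⟶ X := ObjectProperty.homMk ⟨𝟙 _, biprod.fst, Z.obj.g ≫ inv e.hom.τ₃, by simp [K], by
    apply biprod.hom_ext' <;> simp [K, e.hom.comm₂₃_assoc]⟩
  have : IsIso κ.hom.τ₁ := inferInstanceAs (IsIso (𝟙 _))
  have := mono_map κ
  have := epi_map e
  have w : (functor (splitConflations 𝓔)).map κ ≫ (functor (splitConflations 𝓔)).map e = 0 := by
    rw [← Functor.map_comp, map_eq_zero_iff_left]
    exact ⟨biprod.snd, by simp [K, κ]⟩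
  refine ⟨K, κ, w, nonempty_isLimit_kernelFork _ (fun a b ↦ (cancel_mono _).1) ?_,
    nonempty_isColimit_cokernelCofork _ (fun a b ↦ (cancel_epi _).1) ?_⟩
  · rintro ⟨T⟩ t ht
    obtain ⟨t, rfl⟩ := (functor (splitConflations 𝓔)).map_surjective (X := T) (Y := X) t
    rw [← Functor.map_comp, map_eq_zero_iff_homotopy] at ht
    obtain ⟨h, k, h₁, h₂, -⟩ := ht
    -- A null-homotopy `(h, k)` of `t ≫ e` is precisely the data needed to lift `t` to the cone.
    let l : T ⟶ K := ObjectProperty.homMk ⟨t.hom.τ₁, biprod.lift t.hom.τ₂ h, k, by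
      apply biprod.hom_ext <;> simp [K, h₁, t.hom.comm₁₂], by
      simpa [K, sub_eq_iff_eq_add', ← sub_eq_add_neg] using h₂.symm⟩
    refine ⟨(functor (splitConflations 𝓔)).map l, ?_⟩
    rw [← Functor.map_comp, map_eq_iff_left]
    exact ⟨0, by simp [l, κ]⟩
  · rintro ⟨T⟩ t ht
    obtain ⟨t, rfl⟩ := (functor (splitConflations 𝓔)).map_surjective (X := X) (Y := T) t
    rw [← Functor.map_comp, map_eq_zero_iff_left] at ht
    obtain ⟨h, hh⟩ := ht
    replace hh : X.obj.f ≫ biprod.inl ≫ h + e.hom.τ₁ ≫ biprod.inr ≫ h = t.hom.τ₁ := by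
      simpa [K, κ, biprod.lift_eq] using hh
    -- Correcting `t` by the homotopy with component `biprod.inl ≫ h` makes it factor strictly
    -- through `e`, because Z₂ is the pushout of X₂ and Z₁ over X₁.
    obtain ⟨b, hb, hb'⟩ := sq.exists_desc (t.hom.τ₂ - biprod.inl ≫ h ≫ T.obj.f)
      (biprod.inr ≫ h ≫ T.obj.f) (by
        rw [Preadditive.comp_sub, ← t.hom.comm₁₂, ← hh]
        simp)
    obtain ⟨l, hl, -⟩ := exists_hom_of_comm₁₂ (X := Z) (Y := T) (biprod.inr ≫ h) b (by simp [hb'])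
    refine ⟨(functor (splitConflations 𝓔)).map l, ?_⟩
    rw [← Functor.map_comp, map_eq_iff_left]
    exact ⟨-(biprod.inl ≫ h), by simp [hl, ← hh]⟩

/-- A morphism of conflations which is an isomorphism on the subobjects has a cokernel in
the quotient category and is the kernel of it. -/
lemma exists_cokernel (m : Z ⟶ Y) [IsIso m.hom.τ₁] :
    ∃ (D : ConflationCat 𝓔) (π : Y ⟶ D) (w : (functor (splitConflations 𝓔)).map m ≫
      (functor (splitConflations 𝓔)).map π = 0),
      Nonempty (IsLimit (KernelFork.ofι _ w)) ∧ Nonempty (IsColimit (CokernelCofork.ofπ _ w)) := by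
  let D : ConflationCat 𝓔 := ⟨_, biprod_mem_of_isIso_τ₁ Z.property Y.property m.hom⟩
  have sq := isPullback_of_isIso_τ₁ Z.property Y.property m.hom
  -- D is the dual cone Z₂ → Z₃ ⊞ Y₂ → Y₃. The component `-𝟙` matches the sign in its second map.
  let π : Y ⟶ D := ObjectProperty.homMk ⟨inv m.hom.τ₁ ≫ Z.obj.f, biprod.inr, -𝟙 _, by
    apply biprod.hom_ext <;> simp [D, ← m.hom.comm₁₂], by simp [D]⟩
  have : IsIso π.hom.τ₃ := ⟨⟨-𝟙 _, by simp [π, D], by simp [π, D]⟩⟩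
  have := mono_map m
  have := epi_map π
  have w : (functor (splitConflations 𝓔)).map m ≫ (functor (splitConflations 𝓔)).map π = 0 := by
    rw [← Functor.map_comp, map_eq_zero_iff_right]
    exact ⟨-biprod.inl, by simp [D, π]⟩
  refine ⟨D, π, w, nonempty_isLimit_kernelFork _ (fun a b ↦ (cancel_mono _).1) ?_,
    nonempty_isColimit_cokernelCofork _ (fun a b ↦ (cancel_epi _).1) ?_⟩
  · rintro ⟨T⟩ t ht
    obtain ⟨t, rfl⟩ := (functor (splitConflations 𝓔)).map_surjective (X := T) (Y := Y) t
    rw [← Functor.map_comp, map_eq_zero_iff_right] at ht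
    obtain ⟨k, hk⟩ := ht
    replace hk : t.hom.τ₃ = (k ≫ biprod.snd) ≫ Y.obj.g - (k ≫ biprod.fst) ≫ m.hom.τ₃ := by
      have : k ≫ biprod.fst ≫ m.hom.τ₃ - k ≫ biprod.snd ≫ Y.obj.g = -t.hom.τ₃ := by
        simpa [D, π, biprod.desc_eq, sub_eq_add_neg] using hk
      simp [← neg_eq_iff_eq_neg.2 this]
    obtain ⟨b, hb, hb'⟩ := sq.exists_lift (-(T.obj.g ≫ k ≫ biprod.fst))
      (t.hom.τ₂ - T.obj.g ≫ k ≫ biprod.snd) (by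
        rw [Preadditive.sub_comp, t.hom.comm₂₃, hk]
        simp)
    obtain ⟨l, -, hl⟩ := exists_hom_of_comm₂₃ (X := T) (Y := Z) b (-(k ≫ biprod.fst))
      (by simp [hb])
    refine ⟨(functor (splitConflations 𝓔)).map l, ?_⟩
    rw [← Functor.map_comp, map_eq_iff_right]
    exact ⟨-(k ≫ biprod.snd), by simp [hl, hk]; abel⟩
  · rintro ⟨T⟩ t ht
    obtain ⟨t, rfl⟩ := (functor (splitConflations 𝓔)).map_surjective (X := Y) (Y := T) t
    rw [← Functor.map_comp, map_eq_zero_iff_homotopy] at ht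
    obtain ⟨h, k, h₁, h₂, -⟩ := ht
    obtain ⟨l, hl, -⟩ := exists_hom_of_comm₁₂ (X := D) (Y := T) h (biprod.desc (-k) t.hom.τ₂) (by
      simp only [ObjectProperty.FullSubcategory.comp_hom, ShortComplex.comp_τ₂] at h₂
      simp [D, ← h₂])
    refine ⟨(functor (splitConflations 𝓔)).map l, ?_⟩
    rw [← Functor.map_comp, map_eq_iff_left]
    exact ⟨0, by simp [hl, π, h₁]⟩

/-- Every morphism of conflations factors as a morphism which is the identity on quotient objects
followed by a morphism which is the identity on subobjects. -/
lemma exists_factorization (f : X ⟶ Y) :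
    ∃ (Z : ConflationCat 𝓔) (e : X ⟶ Z) (m : Z ⟶ Y), IsIso e.hom.τ₃ ∧ IsIso m.hom.τ₁ ∧
      e ≫ m = f := by
  -- Z is the pushout of the extension X along `f.hom.τ₁`: it has the subobject of Y and the
  -- quotient object of X.
  obtain ⟨A, a, i, p, w, sq, hap, h⟩ := exists_mem_isPushout X.property f.hom.τ₁
  obtain ⟨b, hb, hb'⟩ := sq.exists_desc f.hom.τ₂ Y.obj.f f.hom.comm₁₂.symm
  let Z : ConflationCat 𝓔 := ⟨_, h⟩
  let e : X ⟶ Z := ObjectProperty.homMk ⟨f.hom.τ₁, a, 𝟙 _, sq.w.symm, by simp [Z, hap]⟩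
  let m : Z ⟶ Y := ObjectProperty.homMk ⟨𝟙 _, b, f.hom.τ₃, by simp [Z, hb'], sq.hom_ext
    (by simp [Z, reassoc_of% hb, reassoc_of% hap, f.hom.comm₂₃])
    (by simp [Z, reassoc_of% hb', reassoc_of% w])⟩
  refine ⟨Z, e, m, inferInstanceAs (IsIso (𝟙 _)), inferInstanceAs (IsIso (𝟙 _)), ?_⟩
  apply ObjectProperty.hom_ext
  apply ShortComplex.hom_ext <;> simp [e, m, hb]

/-- Since m is mono and e epi in the quotient, the kernel of e and the cokernel of m are those of `e
≫ m`, and Z is at once its coimage and its image. -/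
lemma nonempty_abelianStruct {X Y : AdditiveQuotient (splitConflations 𝓔)} (f : X ⟶ Y) :
    Nonempty (Abelian.AbelianStruct f) := by
  obtain ⟨X⟩ := X
  obtain ⟨Y⟩ := Y
  obtain ⟨f, rfl⟩ := (functor (splitConflations 𝓔)).map_surjective (X := X) (Y := Y) f
  obtain ⟨Z, e, m, he, hm, rfl⟩ := exists_factorization f
  obtain ⟨K, κ, w, ⟨h₁⟩, ⟨h₂⟩⟩ := exists_kernel e
  obtain ⟨D, π, w', ⟨h₃⟩, ⟨h₄⟩⟩ := exists_cokernel m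
  have := mono_map m
  have := epi_map e
  exact ⟨{
    kernelFork := _
    isLimitKernelFork := isKernelCompMono h₁ _ (Functor.map_comp _ _ _)
    cokernelCofork := _
    isColimitCokernelCofork := isCokernelEpiComp h₄ _ (Functor.map_comp _ _ _)
    image := (functor _).obj Z
    imageπ := (functor _).map e
    ι_imageπ := w
    imageIsCokernel := h₂
    imageι := (functor _).map m
    imageι_π := w'
    imageIsKernel := h₃
    fac := (Functor.map_comp _ _ _).symm }⟩

variable (𝓔) in
lemma exists_abelian : ∃ A : Abelian (AdditiveQuotient (splitConflations 𝓔)),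
    A.toPreadditive = AdditiveQuotient.preadditive (splitConflations 𝓔) :=
  ⟨Abelian.mk' (fun _ _ f ↦ nonempty_abelianStruct f), rfl⟩

end ConflationCat

/-! ### Split conflations are cluster tilting -/

namespace ConflationCat

open IsExactStructure

variable {M : Type u} [Category.{v} M] [Preadditive M] [HasZeroObject M] [HasBinaryBiproducts M]
  {𝓔 : ObjectProperty (ShortComplex M)} [IsExactStructure 𝓔]

open ZeroObject

variable (𝓔) in
/-- The split conflation `0 ⟶ A ⟶ A`. -/
noncomputable abbrev zeroId (A : M) : ConflationCat 𝓔 := ⟨_, mem_zero_id 𝓔 (isZero_zero M) A⟩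

variable (𝓔) in
/-- The split conflation `A ⟶ A ⟶ 0`. -/
noncomputable abbrev idZero (A : M) : ConflationCat 𝓔 := ⟨_, mem_id_zero 𝓔 A (isZero_zero M)⟩

lemma splitConflations_zeroId (A : M) : splitConflations 𝓔 (zeroId 𝓔 A) :=
  ⟨⟨0, 𝟙 _, (isZero_zero M).eq_of_src _ _, by simp, by simp⟩⟩

lemma splitConflations_idZero (A : M) : splitConflations 𝓔 (idZero 𝓔 A) :=
  ⟨⟨𝟙 _, 0, by simp, (isZero_zero M).eq_of_src _ _, by simp⟩⟩

/-- A resolution of X by split conflations. In the three degrees it reads 0 → X₁ → X₁, the split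
sequence X₁ → X₁ ⊞ X₂ → X₂, and X itself up to sign. -/
lemma exists_mem_fromSplit (X : ConflationCat 𝓔) :
    ∃ (κ : zeroId 𝓔 X.obj.X₁ ⟶ split 𝓔 X.obj.X₁ X.obj.X₂) (w : κ ≫ fromSplit X = 0),
      degreewiseMiddleSplit 𝓔 (ShortComplex.mk κ (fromSplit X) w) := by
  let κ : zeroId 𝓔 X.obj.X₁ ⟶ split 𝓔 X.obj.X₁ X.obj.X₂ :=
    ObjectProperty.homMk ⟨0, biprod.lift (𝟙 _) (-X.obj.f), -X.obj.f, by simp, by simp⟩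
  have w : κ ≫ fromSplit X = 0 :=
    ObjectProperty.hom_ext _ (ShortComplex.hom_ext _ _ (by simp [κ]) (by simp [κ]) (by simp [κ]))
  let s : (ShortComplex.mk (biprod.lift (𝟙 _) (-X.obj.f)) (biprod.desc X.obj.f (𝟙 _))
      (by simp)).Splitting :=
    ⟨biprod.fst, biprod.inr, by simp, by simp, by
      apply biprod.hom_ext' <;> apply biprod.hom_ext <;> simp⟩
  have h₃ : 𝓔 (ShortComplex.mk (-X.obj.f) X.obj.g (by simp)) := by
    refine of_iso ?_ X.property
    exact ShortComplex.isoMk ⟨-𝟙 _, -𝟙 _, by simp, by simp⟩ (Iso.refl _) (Iso.refl _)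
      (by simp) (by simp)
  exact ⟨κ, w, ⟨mem_zero_id 𝓔 (isZero_zero M) X.obj.X₁, mem_of_splitting s, h₃⟩, ⟨s⟩⟩

lemma exists_mem_toSplit (X : ConflationCat 𝓔) :
    ∃ (π : split 𝓔 X.obj.X₂ X.obj.X₃ ⟶ idZero 𝓔 X.obj.X₃) (w : toSplit X ≫ π = 0),
      degreewiseMiddleSplit 𝓔 (ShortComplex.mk (toSplit X) π w) := by
  let π : split 𝓔 X.obj.X₂ X.obj.X₃ ⟶ idZero 𝓔 X.obj.X₃ :=
    ObjectProperty.homMk ⟨X.obj.g, biprod.desc X.obj.g (-𝟙 _), 0, by simp, by simp⟩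
  have w : toSplit X ≫ π = 0 :=
    ObjectProperty.hom_ext _ (ShortComplex.hom_ext _ _ (by simp [π]) (by simp [π]) (by simp [π]))
  let s : (ShortComplex.mk (biprod.lift (𝟙 _) X.obj.g) (biprod.desc X.obj.g (-𝟙 _))
      (by simp)).Splitting :=
    ⟨biprod.fst, -biprod.inr, by simp, by simp, by
      apply biprod.hom_ext' <;> apply biprod.hom_ext <;> simp⟩
  exact ⟨π, w, ⟨X.property, mem_of_splitting s, mem_id_zero 𝓔 X.obj.X₃ (isZero_zero M)⟩, ⟨s⟩⟩

lemma isPrecover_fromSplit (X : ConflationCat 𝓔) :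
    IsPrecover (splitConflations 𝓔) (fromSplit X) := by
  refine ⟨splitConflations_split _ _, ?_⟩
  rintro Q ⟨s⟩ g
  refine ⟨ObjectProperty.homMk ⟨g.hom.τ₁, biprod.lift (s.r ≫ g.hom.τ₁) (Q.obj.g ≫ s.s ≫ g.hom.τ₂),
    s.s ≫ g.hom.τ₂, ?_, ?_⟩, ?_⟩
  · apply biprod.hom_ext <;> simp
  · simp
  · apply ObjectProperty.hom_ext
    apply ShortComplex.hom_ext
    · simp
    · have := s.id =≫ g.hom.τ₂
      simpa [g.hom.comm₁₂] using this
    · simp [g.hom.comm₂₃]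

lemma isPreenvelope_toSplit (X : ConflationCat 𝓔) :
    IsPreenvelope (splitConflations 𝓔) (toSplit X) := by
  refine ⟨splitConflations_split _ _, ?_⟩
  rintro Q ⟨s⟩ g
  refine ⟨ObjectProperty.homMk ⟨g.hom.τ₂ ≫ s.r,
    biprod.desc (g.hom.τ₂ ≫ s.r ≫ Q.obj.f) (g.hom.τ₃ ≫ s.s), g.hom.τ₃, ?_, ?_⟩, ?_⟩
  · simp
  · apply biprod.hom_ext' <;> simp
  · apply ObjectProperty.hom_ext
    apply ShortComplex.hom_ext
    · simp [← g.hom.comm₁₂_assoc]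
    · have := g.hom.τ₂ ≫= s.id
      simpa [g.hom.comm₂₃_assoc] using this
    · simp

/-- Middle splitting passes to the subobjects through a retraction of A. The splitting of X then
assembles sections in the separate degrees into a section of complexes. -/
lemma extVanishes_of_splitConflations {X A : ConflationCat 𝓔} (hX : splitConflations 𝓔 X)
    (hA : splitConflations 𝓔 A) : ExtVanishes (degreewiseMiddleSplit 𝓔) X A := by
  rintro Y i p w h
  obtain ⟨s⟩ := hX
  obtain ⟨a⟩ := hA
  obtain ⟨ρ, σ, hρ, hσ⟩ : ∃ (ρ : Y.obj.X₂ ⟶ A.obj.X₂) (σ : X.obj.X₂ ⟶ Y.obj.X₂),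
    i.hom.τ₂ ≫ ρ = 𝟙 _ ∧ σ ≫ p.hom.τ₂ = 𝟙 _ := h.2.elim fun s ↦ ⟨s.r, s.s, s.f_r, s.s_g⟩
  obtain ⟨t, ht⟩ : ∃ t : X.obj.X₁ ⟶ Y.obj.X₁, t ≫ p.hom.τ₁ = 𝟙 _ := by
    have e : i.hom.τ₁ ≫ Y.obj.f ≫ ρ ≫ a.r = 𝟙 _ := by
      rw [i.hom.comm₁₂_assoc, reassoc_of% hρ, a.f_r]
    obtain ⟨t⟩ := exists_splitting_of_retraction h.1.1 _ e
    exact ⟨t.s, t.s_g⟩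
  -- A morphism out of the split X is freely given by maps X₁ → Y₁ and X₃ → Y₂; here these are `t`
  -- and `s.s ≫ σ`.
  let τ : X ⟶ Y := ObjectProperty.homMk
    ⟨t, s.r ≫ t ≫ Y.obj.f + X.obj.g ≫ s.s ≫ σ, s.s ≫ σ ≫ Y.obj.g, by simp, by simp⟩
  refine exists_splitting_of_section h τ ?_
  apply ObjectProperty.hom_ext
  apply ShortComplex.hom_ext
  · simpa [τ] using ht
  · have := s.id
    simpa [τ, ← p.hom.comm₁₂, reassoc_of% ht, hσ] using this
  · simp [τ, ← p.hom.comm₂₃, reassoc_of% hσ]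

variable (𝓔) in
lemma isClusterTilting_splitConflations :
    IsClusterTilting (degreewiseMiddleSplit 𝓔) (splitConflations 𝓔) where
  additive := inferInstance
  contravariantlyFinite X := by
    obtain ⟨κ, w, h⟩ := exists_mem_fromSplit X
    exact ⟨_, fromSplit X, isPrecover_fromSplit X, isDeflation h⟩
  covariantlyFinite X := by
    obtain ⟨π, w, h⟩ := exists_mem_toSplit X
    exact ⟨_, toSplit X, isPreenvelope_toSplit X, isInflation h⟩
  mem_iff_left X := by
    refine ⟨fun hX A hA ↦ extVanishes_of_splitConflations hX hA, fun hX ↦ ?_⟩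
    -- Orthogonality to the kernel of the resolution alone suffices: the resolution splits, so X is
    -- a retract of a split conflation.
    obtain ⟨κ, w, h⟩ := exists_mem_fromSplit X
    obtain ⟨s⟩ := hX _ (splitConflations_zeroId _) _ _ _ _ h
    exact splitConflations_of_retract 𝓔 s.s (fromSplit X) s.s_g (splitConflations_split _ _)
  mem_iff_right X := by
    refine ⟨fun hX B hB ↦ extVanishes_of_splitConflations hB hX, fun hX ↦ ?_⟩
    obtain ⟨π, w, h⟩ := exists_mem_toSplit X
    obtain ⟨s⟩ := hX _ (splitConflations_idZero _) _ _ _ _ h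
    exact splitConflations_of_retract 𝓔 (toSplit X) s.r s.f_r (splitConflations_split _ _)

end ConflationCat

/-! ### Uniqueness of the exact substructure -/

section Uniqueness

open IsExactStructure

/-- If the objects of `P` are orthogonal for `𝓕`, and every object admits a deflation from and an
inflation to an object of `P` for `𝓓`, then every conflation of `𝓕` is one of `𝓓`. -/
lemma le_of_extVanishes {C : Type u} [Category.{v} C] [Preadditive C] [HasZeroObject C]
    [HasBinaryBiproducts C] {𝓓 𝓕 : ObjectProperty (ShortComplex C)} [IsExactStructure 𝓓]
    [IsExactStructure 𝓕] {P : ObjectProperty C} (h₁ : StronglyContravariantlyFinite 𝓓 P)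
    (h₂ : StronglyCovariantlyFinite 𝓓 P)
    (h₃ : ∀ {B A : C}, P B → P A → ExtVanishes 𝓕 B A) : 𝓕 ≤ 𝓓 := by
  intro S hS
  obtain ⟨W, f, ⟨hW, -⟩, hf⟩ := h₁ S.X₃
  obtain ⟨V, g, ⟨hV, -⟩, hg⟩ := h₂ S.X₁
  -- After base change to W and cobase change to V the sequence splits, so `i'` is an inflation for
  -- every exact structure. The obscure axiom is then applied to `i ≫ g' = g ≫ i'` and next to `f' ≫
  -- S.g = p ≫ f`, undoing the two changes.
  obtain ⟨Y, f', i, p, w, sq, -, h⟩ := exists_mem_isPullback hS f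
  obtain ⟨Y', g', i', p', w', sq', -, h'⟩ := exists_mem_isPushout h g
  obtain ⟨s⟩ := h₃ hW hV _ _ _ _ h'
  have hi' : IsInflation 𝓓 i' := isInflation (mem_of_splitting s)
  have hip : 𝓓 (ShortComplex.mk i p w) := by
    refine mem_of_isInflation_comp (isCokernel h) g' ?_
    dsimp
    rw [sq'.w]
    exact inflation_comp _ _ hg hi'
  refine mem_of_isDeflation_comp (isKernel hS) f' ?_
  rw [sq.w]
  exact deflation_comp _ _ (isDeflation hip) hf

variable {M : Type u} [Category.{v} M] [Preadditive M] [HasZeroObject M] [HasBinaryBiproducts M]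
  {𝓔 : ObjectProperty (ShortComplex M)} [IsExactStructure 𝓔]

open ConflationCat in
/-- An exact substructure of the degreewise one for which split conflations are orthogonal
consists of sequences which split in the middle degree. -/
lemma le_degreewiseMiddleSplit {𝓓 : ObjectProperty (ShortComplex (ConflationCat 𝓔))}
    [IsExactStructure 𝓓] (h𝓓 : 𝓓 ≤ degreewise 𝓔)
    (h : ∀ {B A : ConflationCat 𝓔}, splitConflations 𝓔 B → splitConflations 𝓔 A →
      ExtVanishes 𝓓 B A) : 𝓓 ≤ degreewiseMiddleSplit 𝓔 := by
  intro S hS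
  -- Both `f` and `g` have split test objects and are identities in the middle degree, so a
  -- splitting after pullback along `f` and pushout along `g` descends to the middle degree of S.
  let f : zeroId 𝓔 S.X₃.obj.X₂ ⟶ S.X₃ := ObjectProperty.homMk ⟨0, 𝟙 _, S.X₃.obj.g, by simp, by simp⟩
  let g : S.X₁ ⟶ idZero 𝓔 S.X₁.obj.X₂ := ObjectProperty.homMk ⟨S.X₁.obj.f, 𝟙 _, 0, by simp, by simp⟩
  obtain ⟨Y, f', i, p, w, sq, -, hip⟩ := exists_mem_isPullback hS f
  obtain ⟨Y', g', i', p', w', sq', -, h'⟩ := exists_mem_isPushout hip g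
  obtain ⟨s⟩ := h (splitConflations_zeroId _) (splitConflations_idZero _) _ _ _ _ h'
  have e : i ≫ g' ≫ s.r = g := by
    have : i' ≫ s.r = 𝟙 _ := s.f_r
    rw [sq'.w_assoc, this, Category.comp_id]
  have e₂ : i.hom.τ₂ ≫ (g' ≫ s.r).hom.τ₂ = 𝟙 _ := congrArg (fun x ↦ x.hom.τ₂) e
  obtain ⟨t, ht⟩ : ∃ t : S.X₃.obj.X₂ ⟶ Y.obj.X₂, t ≫ p.hom.τ₂ = 𝟙 _ := by
    obtain ⟨t⟩ := exists_splitting_of_retraction (h𝓓 _ hip).2.1 _ e₂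
    exact ⟨t.s, t.s_g⟩
  have e₃ : f'.hom.τ₂ ≫ S.g.hom.τ₂ = p.hom.τ₂ := by
    have : f'.hom.τ₂ ≫ S.g.hom.τ₂ = p.hom.τ₂ ≫ 𝟙 _ := congrArg (fun x ↦ x.hom.τ₂) sq.w
    rw [this, Category.comp_id]
  have e₄ : (t ≫ f'.hom.τ₂) ≫ S.g.hom.τ₂ = 𝟙 _ := by rw [Category.assoc, e₃, ht]
  exact ⟨h𝓓 _ hS, exists_splitting_of_section (h𝓓 _ hS).2.1 _ e₄⟩

end Uniqueness

theorem mainTheorem3 {M : Type u} [Category.{v} M] [Preadditive M] [HasZeroObject M]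
    [HasBinaryBiproducts M] (𝓔 : ObjectProperty (ShortComplex M)) [IsExactStructure 𝓔] :
    (∃ A : Abelian (AdditiveQuotient (splitConflations 𝓔)),
      A.toPreadditive = AdditiveQuotient.preadditive (splitConflations 𝓔)) ∧
    IsExactStructure (degreewise 𝓔) ∧
    (IsExactStructure (degreewiseMiddleSplit 𝓔) ∧
      degreewiseMiddleSplit 𝓔 ≤ degreewise 𝓔 ∧
      IsClusterTilting (degreewiseMiddleSplit 𝓔) (splitConflations 𝓔)) ∧
    ∀ 𝓔' : ObjectProperty (ShortComplex (ConflationCat 𝓔)),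
      IsExactStructure 𝓔' → 𝓔' ≤ degreewise 𝓔 → IsClusterTilting 𝓔' (splitConflations 𝓔) →
        𝓔' = degreewiseMiddleSplit 𝓔 := by
  refine ⟨ConflationCat.exists_abelian 𝓔, inferInstance, ⟨inferInstance, fun _ h ↦ h.1,
    ConflationCat.isClusterTilting_splitConflations 𝓔⟩, fun 𝓔' _ h𝓔' h ↦ le_antisymm ?_ ?_⟩
  · exact le_degreewiseMiddleSplit h𝓔' fun {B A} hB hA ↦ (h.mem_iff_left B).1 hB A hA
  · exact le_of_extVanishes h.contravariantlyFinite h.covariantlyFinite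
      ConflationCat.extVanishes_of_splitConflations
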